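/- **Setting.** Let $\Omega=\{1,\dots,I\}$ with probabilities $p_i>0$, $\sum_i p_i=1$. Write $w^{\mathsf T}z$ for the scalar product and $w\cdot z$ for the componentwise product on $\mathbb R^J$. Random vectors $u=(u_1,\dots,u_I)$ with $u_i\in\mathbb R^J$ are ordered componentwise. Let $R$ be a multivariate convex risk measure, i.e. a map from the random vectors in $\mathbb R^J$ to the subsets of $\mathbb R^J$ such that: $u\le v$ implies $R(u)\supseteq R(v)$; $R(u+z)=R(u)+z$ for $z\in\mathbb R^J$; $R(u)\notin\{\emptyset,\mathbb R^J\}$; $R(\gamma' u+(1-\gamma')v)\supseteq\gamma' R(u)+(1-\gamma')R(v)$ for $\gamma'\in(0,1)$; and $\mathcal A=\{u\mid 0\in R(u)\}$ is closed. Let $A,b,C$ be deterministic and $Q_i,W_i,T_i,h_i$ ($i\in\Omega$) random matrices and vectors of matching sizes, put $$\mathcal F_i=\{(x_i,y_i)\mid x_i\ge0,\ y_i\ge 0,\ Ax_i=b,\ T_ix_i+W_iy_i=h_i\},$$ and assume that $\mathcal X=\{(x,(y_i)_i)\mid (x,y_i)\in\mathcal F_i\ \forall i\}$ is nonempty and compact.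 Let $w\in\mathbb R^J_+\setminus\{0\}$ and $$\mathscr P_1(w)=\inf\{w^{\mathsf T}z\mid z\in R(Cx+Qy),\ (x,y)\in\mathcal X\}.$$ For random $x$ with realizations $x_i$, $Cx+Qy$ has realizations $Cx_i+Q_iy_i$. Let $\mathbb M_1^J$ be the set of $\mu=(\mu_i)_{i\in\Omega}$ with $\mu_i\in\mathbb R^J_+$ and $\sum_i\mu_i=\mathbf 1$, and $$f_i(\mu_i,\lambda_i)=\inf_{(x_i,y_i)\in\mathcal F_i}\big(w^{\mathsf T}[\mu_i\cdot(Cx_i+Q_iy_i)]+p_i\lambda_i^{\mathsf T}x_i\big),\qquad \beta(\mu)=\sup_{u\in\mathcal A}w^{\mathsf T}\sum_{i}\mu_i\cdot u_i .$$ **Dual bundle method.** Fix $\varrho>0$, $\gamma\in(0,1)$ and a starting point $\mu^{(1)}\in\mathbb M_1^J$, $\lambda^{(1)}$ with $\sum_ip_i\lambda_i^{(1)}=0$; start with $\mathcal L=\emptyset$. Iteration $k=1,2,\dots$ is as follows. 1. For each $i$ compute a minimizer $(x_i^{(k)},y_i^{(k)})$ of the problem defining $f_i(\mu_i^{(k)},\lambda_i^{(k)})$;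 put $g_{\mu_i^{(k)}}=w\cdot(Cx_i^{(k)}+Q_iy_i^{(k)})$ and $g_{\lambda_i^{(k)}}=p_ix_i^{(k)}$. Compute $\beta(\mu^{(k)})$ (finite) and $\rho^{(k)}=(\rho^{(k)}_i)_i$ with $-\beta(\mu)\le-\beta(\mu^{(k)})+\sum_i(\rho_i^{(k)})^{\mathsf T}(\mu_i-\mu_i^{(k)})$ for all $\mu\in\mathbb M_1^J$. Put $F^{(k)}=\sum_if_i(\mu_i^{(k)},\lambda_i^{(k)})-\beta(\mu^{(k)})$. 2. Add $k$ to the index set $\mathcal L$ if $k=1$ or $F^{(k)}<\sum_i\vartheta_i^{(k)}+\eta^{(k)}$; otherwise adding it is optional. 3. If $k=1$, or $k\ge2$ and $F^{(k)}\ge(1-\gamma)\bar F^{(k)}+\gamma(\sum_i\vartheta_i^{(k)}+\eta^{(k)})$ (a *descent iteration*), set the centers $(\bar\mu^{(k)},\bar\lambda^{(k)})=(\mu^{(k)},\lambda^{(k)})$; otherwise $(\bar\mu^{(k)},\bar\lambda^{(k)})=(\bar\mu^{(k-1)},\bar\lambda^{(k-1)})$. 4. Let $(\mu^{(k+1)},\lambda^{(k+1)},\vartheta^{(k+1)},\eta^{(k+1)})$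 be an optimal solution of the master problem $MP_1(w)$ with centers $\bar\mu^{(k)},\bar\lambda^{(k)}$ and index set $\mathcal L$: maximize $\sum_i\vartheta_i+\eta-\varrho\sum_i\|\mu_i-\bar\mu_i^{(k)}\|^2-\varrho\sum_i\|\lambda_i-\bar\lambda_i^{(k)}\|^2$ (Euclidean norms) subject to, for $i\in\Omega$ and $\ell\in\mathcal L$, $$\vartheta_i\le f_i(\mu_i^{(\ell)},\lambda_i^{(\ell)})+g_{\mu_i^{(\ell)}}^{\mathsf T}(\mu_i-\mu_i^{(\ell)})+g_{\lambda_i^{(\ell)}}^{\mathsf T}(\lambda_i-\lambda_i^{(\ell)}),$$ $$\eta\le-\beta(\mu^{(\ell)})+\sum_{i}(\rho_i^{(\ell)})^{\mathsf T}(\mu_i-\mu_i^{(\ell)}),$$ $$\sum_ip_i\lambda_i=0,\qquad \sum_i\mu_i=\mathbf 1,\qquad \mu_i\ge 0 .$$ Put $\bar F^{(k+1)}=\sum_if_i(\bar\mu_i^{(k)},\bar\lambda_i^{(k)})-\beta(\bar\mu^{(k)})$. **Recovery.** For $\varepsilon>0$ let $k$ be the first iteration with $\sum_i\vartheta_i^{(k+1)}+\eta^{(k+1)}-\bar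 F^{(k+1)}\le\varepsilon$, let $n+1$ be the first descent iteration after $k$, and let $\mathcal L'$ be the index set in iteration $n$ ($\mathcal L'=\{1,\dots,n\}$ if all cuts are added). Assign to the five groups of constraints of $MP_1(w)$ with centers $\bar\mu^{(k)},\bar\lambda^{(k)}$ and index set $\mathcal L'$, in the above order, the multipliers $\tau_i^{(\ell)}\ge0$, $\theta^{(\ell)}\ge0$, $\sigma\in\mathbb R^M$, $\Psi\in\mathbb R^J$, $\nu_i\in\mathbb R^J_+$, the last three entering the Lagrangian as $-\sigma^{\mathsf T}\sum_ip_i\lambda_i+\Psi^{\mathsf T}(\mathbf 1-\sum_i\mu_i)+\sum_i\nu_i^{\mathsf T}\mu_i$. Let $(\tau,\theta,\sigma,\Psi,\nu)$ be an optimal solution of the Lagrangian dual, put $$(x_{(w)})_i=\sum_{\ell\in\mathcal L'}\tau_i^{(\ell)}x_i^{(\ell)},\qquad (y_{(w)})_i=\sum_{\ell\in\mathcal L'}\tau_i^{(\ell)}y_i^{(\ell)},$$ and let $z_{(w)}$ be a minimizer of $w^{\mathsf T}z$ over $z\in R(Cx_{(w)}+Qy_{(w)})$. **Theorem.** In this setting: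 (a) $((x_{(w)})_i,(y_{(w)})_i)\in\mathcal F_i$ for each $i\in\Omega$. (b) $z_{(w)}\in R(Cx_{(w)}+Qy_{(w)})$. (c) As $\varepsilon\to0$, $(x_{(w)})_i-\sigma\to0$ for each $i\in\Omega$. (d) As $\varepsilon\to0$, $w^{\mathsf T}z_{(w)}\to\mathscr P_1(w)$. Here the limits mean: for every $\delta>0$ there is $\varepsilon_0>0$, depending only on $\delta$, the problem data, $R$, $w$, $\varrho$, $\gamma$ and the starting point, such that for every $0<\varepsilon\le\varepsilon_0$ and every run of the method that reaches the iteration $n+1$ belonging to $\varepsilon$, one has $\|(x_{(w)})_i-\sigma\|<\delta$ for all $i$ and $|w^{\mathsf T}z_{(w)}-\mathscr P_1(w)|<\delta$. -/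

import Mathlib

open scoped Matrix

noncomputable section

namespace TwoStage

/-- The data of the two-stage problem: scenarios `Fin I` with probabilities `p i > 0`, the
first-stage constraint `A x = b`, `x ≥ 0`, with cost `C x`, and in scenario `i` the second-stage
constraint `T i x + W i y = h i`, `y ≥ 0`, with cost `Q i y`. -/
structure Data (I J K L M N : ℕ) where
  p : Fin I → ℝ
  p_pos : ∀ i, 0 < p i
  p_sum : ∑ i, p i = 1
  A : Matrix (Fin K) (Fin M) ℝ
  b : Fin K → ℝ
  C : Matrix (Fin J) (Fin M) ℝ
  Q : Fin I → Matrix (Fin J) (Fin N) ℝ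
  W : Fin I → Matrix (Fin L) (Fin N) ℝ
  T : Fin I → Matrix (Fin L) (Fin M) ℝ
  h : Fin I → Fin L → ℝ

/-- A multivariate convex risk measure on the `J`-dimensional random cost vectors `u`
(`u i` is the realization in scenario `i`; the order on random vectors is the componentwise one). -/
structure IsConvexRiskMeasure {I J : ℕ} (R : (Fin I → Fin J → ℝ) → Set (Fin J → ℝ)) : Prop where
  monotone : ∀ u v, u ≤ v → R v ⊆ R u
  translative : ∀ (u : Fin I → Fin J → ℝ) (z : Fin J → ℝ),
    R (fun i => u i + z) = (fun r => r + z) '' R u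
  finite : ∀ u, R u ≠ ∅ ∧ R u ≠ Set.univ
  convex : ∀ (u v : Fin I → Fin J → ℝ) (γ : ℝ), 0 < γ → γ < 1 →
    ∀ r ∈ R u, ∀ s ∈ R v, γ • r + (1 - γ) • s ∈ R (γ • u + (1 - γ) • v)
  closed : IsClosed {u | 0 ∈ R u}

/-- The vectors `μ = (μ¹, …, μᴶ)` of probability measures on the scenarios; `μ i j` is the mass
that `μʲ` gives to scenario `i`. -/
def probVectors (I J : ℕ) : Set (Fin I → Fin J → ℝ) :=
  {μ | (∀ i j, 0 ≤ μ i j) ∧ ∀ j, ∑ i, μ i j = 1}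

/-- `wᵀ E^μ[u]`, where `E^μ[u] = ∑ i, μ i · u i` with the Hadamard product. -/
def weightedExp {I J : ℕ} (w : Fin J → ℝ) (μ u : Fin I → Fin J → ℝ) : ℝ :=
  w ⬝ᵥ ∑ i, μ i * u i

/-- The minimal penalty function `β(μ, w)` of `R`; it may take the value `+∞`. -/
def penalty {I J : ℕ} (R : (Fin I → Fin J → ℝ) → Set (Fin J → ℝ))
    (μ : Fin I → Fin J → ℝ) (w : Fin J → ℝ) : EReal :=
  ⨆ u ∈ {u : Fin I → Fin J → ℝ | 0 ∈ R u}, ((weightedExp w μ u : ℝ) : EReal)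

/-- `ρ` is a subgradient of the concave function `-β(·, w)` at `μ'`. -/
def IsPenaltySubgradient {I J : ℕ} (R : (Fin I → Fin J → ℝ) → Set (Fin J → ℝ))
    (w : Fin J → ℝ) (μ' ρ : Fin I → Fin J → ℝ) : Prop :=
  ∀ μ ∈ probVectors I J,
    -penalty R μ w ≤ -penalty R μ' w + ((∑ i, ρ i ⬝ᵥ (μ i - μ' i) : ℝ) : EReal)

section Problem

variable {I J K L M N : ℕ} (D : Data I J K L M N)

/-- The feasible set `X` of the pairs `(x, y)` with a deterministic first stage `x`. -/
def feasibleSet : Set ((Fin M → ℝ) × (Fin I → Fin N → ℝ)) :=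
  {v | 0 ≤ v.1 ∧ 0 ≤ v.2 ∧ D.A *ᵥ v.1 = D.b ∧ ∀ i, D.T i *ᵥ v.1 + D.W i *ᵥ v.2 i = D.h i}

/-- The feasible set `F_i` of scenario `i`. -/
def scenarioSet (i : Fin I) : Set ((Fin M → ℝ) × (Fin N → ℝ)) :=
  {v | 0 ≤ v.1 ∧ 0 ≤ v.2 ∧ D.A *ᵥ v.1 = D.b ∧ D.T i *ᵥ v.1 + D.W i *ᵥ v.2 = D.h i}

/-- The cost vector `C x + Q_i y` in scenario `i`. -/
def scenarioCost (i : Fin I) (x : Fin M → ℝ) (y : Fin N → ℝ) : Fin J → ℝ :=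
  D.C *ᵥ x + D.Q i *ᵥ y

/-- The random cost vector `Cx + Qy`, for a first-stage decision that may depend on the
scenario. -/
def totalCost (x : Fin I → Fin M → ℝ) (y : Fin I → Fin N → ℝ) : Fin I → Fin J → ℝ :=
  fun i => scenarioCost D i (x i) (y i)

/-- The optimal value of `min wᵀz` over `z ∈ R(Cx + Qy)`, `(x, y) ∈ X`, in the extended reals. -/
def optimalValue (R : (Fin I → Fin J → ℝ) → Set (Fin J → ℝ)) (w : Fin J → ℝ) : EReal :=
  ⨅ v ∈ feasibleSet D, ⨅ z ∈ R (totalCost D (fun _ => v.1) v.2), ((w ⬝ᵥ z : ℝ) : EReal)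

/-- The objective of the subproblem of scenario `i`. -/
def subObjective (w : Fin J → ℝ) (i : Fin I) (μi : Fin J → ℝ) (lami : Fin M → ℝ)
    (v : (Fin M → ℝ) × (Fin N → ℝ)) : ℝ :=
  w ⬝ᵥ (μi * scenarioCost D i v.1 v.2) + D.p i * (lami ⬝ᵥ v.1)

/-- `f_i(μ_i, λ_i, w)`, the optimal value of the subproblem of scenario `i`. -/
def subValue (w : Fin J → ℝ) (i : Fin I) (μi : Fin J → ℝ) (lami : Fin M → ℝ) : EReal :=
  ⨅ v ∈ scenarioSet D i, ((subObjective D w i μi lami v : ℝ) : EReal)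

/-- The objective `∑ i, f_i(μ_i, λ_i, w) - β(μ, w)` of the dual problem. -/
def dualObjective (R : (Fin I → Fin J → ℝ) → Set (Fin J → ℝ)) (w : Fin J → ℝ)
    (μ : Fin I → Fin J → ℝ) (lam : Fin I → Fin M → ℝ) : EReal :=
  (∑ i, subValue D w i (μ i) (lam i)) - penalty R μ w

/-- The condition `E[λ] = 0`. -/
def MeanZero (lam : Fin I → Fin M → ℝ) : Prop := ∑ i, D.p i • lam i = 0

end Problem

/-- Everything that the dual bundle method records. Iterations are numbered from `1`; entries with
index `0` play no role, except that the index set `idx 0` is the empty one. In iteration `k`: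
`mu k, lam k` is the dual iterate, `vartheta k, eta k` are the remaining master variables found
together with it (for `k ≥ 2`), `x k i, y k i` is the subproblem solution of scenario `i`,
`fval k i` and `bval k` are the computed values of `f_i` and `β`, `rho k` is the computed
subgradient of `-β`, `idx k` is the index set of the cuts, `cmu k, clam k` are the centers, and
`Fbar (k + 1)` is the dual objective at these centers. -/
structure Trace (I J M N : ℕ) where
  mu : ℕ → Fin I → Fin J → ℝ
  lam : ℕ → Fin I → Fin M → ℝ
  vartheta : ℕ → Fin I → ℝ
  eta : ℕ → ℝ
  x : ℕ → Fin I → Fin M → ℝ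
  y : ℕ → Fin I → Fin N → ℝ
  fval : ℕ → Fin I → ℝ
  bval : ℕ → ℝ
  rho : ℕ → Fin I → Fin J → ℝ
  idx : ℕ → Finset ℕ
  cmu : ℕ → Fin I → Fin J → ℝ
  clam : ℕ → Fin I → Fin M → ℝ
  Fbar : ℕ → ℝ

/-- The variables `(μ, λ, ϑ, η)` of the master problem. -/
structure MasterVars (I J M : ℕ) where
  mu : Fin I → Fin J → ℝ
  lam : Fin I → Fin M → ℝ
  vartheta : Fin I → ℝ
  eta : ℝ

/-- The Lagrange multipliers of the master problem: `τ` and `θ` for the cuts, `σ` for `E[λ] = 0`,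
`Ψ` for `∑ i, μ i = 1`, and `ν` for `μ ≥ 0`. The entries of `τ i` and `θ` outside the index set of
the cuts are never used. -/
structure DualVars (I J M : ℕ) where
  τ : Fin I → ℕ → ℝ
  θ : ℕ → ℝ
  σ : Fin M → ℝ
  Ψ : Fin J → ℝ
  ν : Fin I → Fin J → ℝ

namespace Trace

variable {I J K L M N : ℕ} (t : Trace I J M N) (D : Data I J K L M N) (w : Fin J → ℝ)

/-- `F^(k)`, the dual objective at the `k`-th iterate. -/
def F (k : ℕ) : ℝ := (∑ i, t.fval k i) - t.bval k

/-- `∑ i, ϑ_i^(k) + η^(k)`. -/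
def modelValue (k : ℕ) : ℝ := (∑ i, t.vartheta k i) + t.eta k

/-- The subgradient `w · (C x_i + Q_i y_i)` of `f_i` with respect to `μ_i`. -/
def gmu (ℓ : ℕ) (i : Fin I) : Fin J → ℝ := w * scenarioCost D i (t.x ℓ i) (t.y ℓ i)

/-- The subgradient `p_i x_i` of `f_i` with respect to `λ_i`. -/
def glam (ℓ : ℕ) (i : Fin I) : Fin M → ℝ := D.p i • t.x ℓ i

/-- The right-hand side of the `ℓ`-th cut for `f_i`. -/
def fCut (ℓ : ℕ) (i : Fin I) (μi : Fin J → ℝ) (lami : Fin M → ℝ) : ℝ :=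
  t.fval ℓ i + t.gmu D w ℓ i ⬝ᵥ (μi - t.mu ℓ i) + t.glam D ℓ i ⬝ᵥ (lami - t.lam ℓ i)

/-- The right-hand side of the `ℓ`-th cut for `-β`. -/
def bCut (ℓ : ℕ) (μ : Fin I → Fin J → ℝ) : ℝ :=
  -t.bval ℓ + ∑ i, t.rho ℓ i ⬝ᵥ (μ i - t.mu ℓ i)

/-- The objective of the master problem with the centers of iteration `k`. -/
def masterObjective (ϱ : ℝ) (k : ℕ) (q : MasterVars I J M) : ℝ :=
  (∑ i, q.vartheta i) + q.eta
    - ∑ i, ϱ * ∑ j, (q.mu i j - t.cmu k i j) ^ 2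
    - ∑ i, ϱ * ∑ m, (q.lam i m - t.clam k i m) ^ 2

/-- The constraints of the master problem with the cuts of the index set `S`. -/
structure MasterFeasible (S : Finset ℕ) (q : MasterVars I J M) : Prop where
  cut_f : ∀ i, ∀ ℓ ∈ S, q.vartheta i ≤ t.fCut D w ℓ i (q.mu i) (q.lam i)
  cut_b : ∀ ℓ ∈ S, q.eta ≤ t.bCut ℓ q.mu
  mean_zero : ∑ i, D.p i • q.lam i = 0
  mu_sum : ∑ i, q.mu i = 1
  mu_nonneg : ∀ i j, 0 ≤ q.mu i j

/-- `q` is optimal for the master problem with the centers of iteration `k` and the index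
set `S`. -/
def IsMasterOptimal (ϱ : ℝ) (k : ℕ) (S : Finset ℕ) (q : MasterVars I J M) : Prop :=
  t.MasterFeasible D w S q ∧
    ∀ q', t.MasterFeasible D w S q' → t.masterObjective ϱ k q' ≤ t.masterObjective ϱ k q

/-- The Lagrangian of the master problem with the centers of iteration `k` and the index
set `S`. -/
def lagrangian (ϱ : ℝ) (k : ℕ) (S : Finset ℕ) (q : MasterVars I J M) (d : DualVars I J M) : ℝ :=
  t.masterObjective ϱ k q
    + ∑ i, ∑ ℓ ∈ S, d.τ i ℓ * (t.fCut D w ℓ i (q.mu i) (q.lam i) - q.vartheta i)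
    + ∑ ℓ ∈ S, d.θ ℓ * (t.bCut ℓ q.mu - q.eta)
    - d.σ ⬝ᵥ ∑ i, D.p i • q.lam i
    + d.Ψ ⬝ᵥ (1 - ∑ i, q.mu i)
    + ∑ i, d.ν i ⬝ᵥ q.mu i

/-- The Lagrangian dual function of the master problem; it may take the value `+∞`. -/
def dualFunction (ϱ : ℝ) (k : ℕ) (S : Finset ℕ) (d : DualVars I J M) : EReal :=
  ⨆ q : MasterVars I J M, ((t.lagrangian D w ϱ k S q d : ℝ) : EReal)

/-- The sign constraints on the multipliers. -/
structure _root_.TwoStage.DualVars.Feasible (S : Finset ℕ) (d : DualVars I J M) : Prop where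
  τ_nonneg : ∀ i, ∀ ℓ ∈ S, 0 ≤ d.τ i ℓ
  θ_nonneg : ∀ ℓ ∈ S, 0 ≤ d.θ ℓ
  ν_nonneg : ∀ i j, 0 ≤ d.ν i j

/-- `d` is optimal for the Lagrangian dual of the master problem with the centers of iteration `k`
and the index set `S`. -/
def IsDualOptimal (ϱ : ℝ) (k : ℕ) (S : Finset ℕ) (d : DualVars I J M) : Prop :=
  d.Feasible S ∧
    ∀ d' : DualVars I J M, d'.Feasible S →
      t.dualFunction D w ϱ k S d ≤ t.dualFunction D w ϱ k S d'

/-- Iteration `k` is a descent iteration: the centers are moved to the current iterate. -/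
def IsDescent (γ : ℝ) (k : ℕ) : Prop :=
  k = 1 ∨ (2 ≤ k ∧ (1 - γ) * t.Fbar k + γ * t.modelValue k ≤ t.F k)

/-- The part of iteration `k` before the master problem: the subproblems are solved, `β` is
evaluated (in particular it is finite at the iterate) together with a subgradient, and the index
set and the centers are updated. The new cut is added in iteration `1` and whenever
`F^(k) < ∑ i, ϑ_i^(k) + η^(k)`; otherwise it may be added or not. -/
structure IsEvaluation (R : (Fin I → Fin J → ℝ) → Set (Fin J → ℝ)) (γ : ℝ) (k : ℕ) : Prop where
  sub_feasible : ∀ i, (t.x k i, t.y k i) ∈ scenarioSet D i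
  sub_optimal : ∀ i, ∀ v ∈ scenarioSet D i,
    subObjective D w i (t.mu k i) (t.lam k i) (t.x k i, t.y k i)
      ≤ subObjective D w i (t.mu k i) (t.lam k i) v
  fval_eq : ∀ i, ((t.fval k i : ℝ) : EReal) = subValue D w i (t.mu k i) (t.lam k i)
  bval_eq : ((t.bval k : ℝ) : EReal) = penalty R (t.mu k) w
  rho_subgradient : IsPenaltySubgradient R w (t.mu k) (t.rho k)
  idx_update : t.idx k = insert k (t.idx (k - 1)) ∨
    (2 ≤ k ∧ ¬ t.F k < t.modelValue k ∧ t.idx k = t.idx (k - 1))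
  center_descent : t.IsDescent γ k → t.cmu k = t.mu k ∧ t.clam k = t.lam k
  center_null : ¬ t.IsDescent γ k → t.cmu k = t.cmu (k - 1) ∧ t.clam k = t.clam (k - 1)

/-- The rest of iteration `k`: the master problem is solved, which yields the next iterate, and the
dual objective at the centers is recorded. -/
structure IsMasterStep (R : (Fin I → Fin J → ℝ) → Set (Fin J → ℝ)) (ϱ : ℝ) (k : ℕ) : Prop where
  master : t.IsMasterOptimal D w ϱ k (t.idx k)
    ⟨t.mu (k + 1), t.lam (k + 1), t.vartheta (k + 1), t.eta (k + 1)⟩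
  Fbar_eq : ((t.Fbar (k + 1) : ℝ) : EReal) = dualObjective D R w (t.cmu k) (t.clam k)

/-- The trace `t` follows the dual bundle method, started at `(μ₁, lam₁)`, up to the center update
of iteration `m`. -/
structure IsRun (R : (Fin I → Fin J → ℝ) → Set (Fin J → ℝ)) (ϱ γ : ℝ)
    (μ₁ : Fin I → Fin J → ℝ) (lam₁ : Fin I → Fin M → ℝ) (m : ℕ) : Prop where
  start_mu : t.mu 1 = μ₁
  start_lam : t.lam 1 = lam₁
  idx_zero : t.idx 0 = ∅
  evaluation : ∀ k, 1 ≤ k → k ≤ m → t.IsEvaluation D w R γ k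
  master_step : ∀ k, 1 ≤ k → k < m → t.IsMasterStep D w R ϱ k

/-- `k` is the last iteration under the approximate stopping rule with tolerance `ε`, that is, the
first iteration at the end of which `∑ i, ϑ_i^(k+1) + η^(k+1) - Fbar^(k+1) ≤ ε`. -/
def IsStopIteration (ε : ℝ) (k : ℕ) : Prop :=
  IsLeast {k : ℕ | 1 ≤ k ∧ t.modelValue (k + 1) - t.Fbar (k + 1) ≤ ε} k

/-- `m` is the first descent iteration after iteration `k`. -/
def IsNextDescent (γ : ℝ) (k m : ℕ) : Prop :=
  IsLeast {m : ℕ | k < m ∧ t.IsDescent γ m} m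

/-- The recovered first-stage decision `∑ ℓ, τ_i^(ℓ) x_i^(ℓ)`, summed over the index set `S`. -/
def recX (S : Finset ℕ) (d : DualVars I J M) : Fin I → Fin M → ℝ :=
  fun i => ∑ ℓ ∈ S, d.τ i ℓ • t.x ℓ i

/-- The recovered second-stage decision `∑ ℓ, τ_i^(ℓ) y_i^(ℓ)`, summed over the index set `S`. -/
def recY (S : Finset ℕ) (d : DualVars I J M) : Fin I → Fin N → ℝ :=
  fun i => ∑ ℓ ∈ S, d.τ i ℓ • t.y ℓ i

/-- The recovery of a primal solution for the tolerance `ε`: the bundle method is stopped in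
iteration `k`, is continued up to the next descent iteration `n + 1`, `d` is an optimal dual
solution of the master problem with the centers of iteration `k` and the cuts of iteration `n`,
and `z` minimizes `wᵀz` over `R(Cx + Qy)` at the recovered `(x, y)`. -/
structure IsRecovery (R : (Fin I → Fin J → ℝ) → Set (Fin J → ℝ)) (ϱ γ : ℝ)
    (μ₁ : Fin I → Fin J → ℝ) (lam₁ : Fin I → Fin M → ℝ)
    (ε : ℝ) (k n : ℕ) (d : DualVars I J M) (z : Fin J → ℝ) : Prop where
  run : t.IsRun D w R ϱ γ μ₁ lam₁ (n + 1)
  stopped : t.IsStopIteration ε k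
  descent : t.IsNextDescent γ k (n + 1)
  dual : t.IsDualOptimal D w ϱ k (t.idx n) d
  z_mem : z ∈ R (totalCost D (t.recX (t.idx n) d) (t.recY (t.idx n) d))
  z_min : ∀ z' ∈ R (totalCost D (t.recX (t.idx n) d) (t.recY (t.idx n) d)), w ⬝ᵥ z ≤ w ⬝ᵥ z'

end Trace

end TwoStage

end

open TwoStage

noncomputable section

namespace TwoStage

/-! Scenario feasibility comes from the multipliers. The variables `vartheta i` and `eta` enter the
Lagrangian linearly, so the dual value is finite only if the cut multipliers sum to one; the
recovered pair is then a convex combination of points of the convex set `scenarioSet D i`.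

Both limits rest on the last proximal step being of order `√ε`. From the stopping iteration up to
the next descent iteration the centers are fixed and cuts are only added, so the last master value
exceeds the dual value at the centers by at most `ε`. The centers are themselves feasible, and
strong concavity turns this gap into a bound on the squared step (`IsRecovery.sqDist_step_le`).
Stationarity in `λ` identifies `x_i - σ` with a multiple of the `λ`-step (`IsRecovery.recX_sub`).

For the optimal value, separation at the minimizer `z` gives a vector `μ` of probability measures
that supports the scalarized risk (`exists_probVector_of_minimizer`). The Lagrangian at `(μ, 0)`
bounds `wᵀz` by the dual value at the centers plus differences of squared distances
(`IsRecovery.dotProduct_le`). These are of order `√ε`, uniformly over all runs, once the centers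
stay bounded. That holds because the squared distance to a dual optimal point telescopes, the
descent test paying for each increase (`IsRun.sqDist_center_le`). A dual optimal point exists: `μ`
ranges over a compact set, and `λ` is supplied by Farkas' lemma (`exists_isDualBound_max`). Weak
duality now bounds `wᵀz` from above by the optimal value plus a small error. Conversely, the
recovered decision is nearly nonanticipative, hence close in cost to a feasible one
(`exists_feasible_cost_near`), which gives the other inequality. -/

/-! ### Farkas' lemma and separable lower bounds. -/

/-- **Farkas' lemma** for a finite family of linear functionals. -/
theorem exists_nonneg_combination_of_forall_nonpos {V ι : Type*} [AddCommGroup V] [Module ℝ V]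
    (s : Finset ι) (a : ι → V →ₗ[ℝ] ℝ) (c : V →ₗ[ℝ] ℝ)
    (h : ∀ v, (∀ k ∈ s, a k v ≤ 0) → c v ≤ 0) :
    ∃ y : ι → ℝ, (∀ k ∈ s, 0 ≤ y k) ∧ ∀ v, c v = ∑ k ∈ s, y k * a k v := by
  classical
  induction s using Finset.induction_on generalizing a c with
  | empty =>
    refine ⟨0, by simp, fun v => ?_⟩
    have h1 := h v (by simp)
    have h2 := h (-v) (by simp)
    rw [map_neg] at h2
    simp only [Finset.sum_empty]
    linarith
  | insert m s hm ih =>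
    -- If the new inequality is redundant, it gets multiplier zero. Otherwise some `v₀` satisfies
    -- the old inequalities with `c v₀ > 0`, so `a m v₀ > 0`, and one projects along `v₀` onto the
    -- kernel of `a m`.
    by_cases hc : ∀ v, (∀ k ∈ s, a k v ≤ 0) → c v ≤ 0
    · obtain ⟨y, hy, hcy⟩ := ih a c hc
      refine ⟨Function.update y m 0, fun k hk => ?_, fun v => ?_⟩
      · by_cases hkm : k = m
        · simp [hkm]
        · simpa [hkm] using hy k ((Finset.mem_insert.1 hk).resolve_left hkm)
      · rw [Finset.sum_insert hm, hcy]
        simp only [Function.update_self, zero_mul, zero_add]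
        refine Finset.sum_congr rfl fun k hk => ?_
        rw [Function.update_of_ne (ne_of_mem_of_not_mem hk hm)]
    · push Not at hc
      obtain ⟨v₀, hv₀, hcv₀⟩ := hc
      have ham : 0 < a m v₀ := by
        by_contra hle
        refine absurd (h v₀ fun k hk => ?_) (not_le.2 hcv₀)
        rcases Finset.mem_insert.1 hk with rfl | hk
        · exact not_lt.1 hle
        · exact hv₀ k hk
      set α := a m v₀ with hα
      obtain ⟨y, hy, hcy⟩ := ih (fun k => a k - (a k v₀ / α) • a m) (c - (c v₀ / α) • a m) (by
        intro v hv
        have h1 := h (v - (a m v / α) • v₀) (by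
          intro k hk
          rcases Finset.mem_insert.1 hk with rfl | hk
          · simp only [map_sub, map_smul, smul_eq_mul, ← hα]
            rw [div_mul_cancel₀ _ ham.ne', sub_self]
          · have := hv k hk
            simp only [LinearMap.sub_apply, LinearMap.smul_apply, smul_eq_mul] at this
            simp only [map_sub, map_smul, smul_eq_mul]
            calc _ = a k v - a k v₀ / α * a m v := by ring
              _ ≤ 0 := this)
        simp only [map_sub, map_smul, smul_eq_mul] at h1
        simp only [LinearMap.sub_apply, LinearMap.smul_apply, smul_eq_mul]
        calc _ = c v - a m v / α * c v₀ := by ring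
          _ ≤ 0 := h1)
      -- This is the coefficient of `a m` after undoing the projection; its sign is right because
      -- `v₀` satisfies the old inequalities.
      have hnn : 0 ≤ c v₀ / α - ∑ k ∈ s, y k * (a k v₀ / α) := by
        have : ∑ k ∈ s, y k * (a k v₀ / α) ≤ 0 :=
          Finset.sum_nonpos fun k hk => mul_nonpos_of_nonneg_of_nonpos (hy k hk)
            (div_nonpos_of_nonpos_of_nonneg (hv₀ k hk) ham.le)
        have := div_pos hcv₀ ham
        linarith
      refine ⟨Function.update y m (c v₀ / α - ∑ k ∈ s, y k * (a k v₀ / α)), fun k hk => ?_,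
        fun v => ?_⟩
      · by_cases hkm : k = m
        · subst hkm; simpa using hnn
        · simpa [hkm] using hy k ((Finset.mem_insert.1 hk).resolve_left hkm)
      · have h1 := hcy v
        simp only [LinearMap.sub_apply, LinearMap.smul_apply, smul_eq_mul, mul_sub,
          Finset.sum_sub_distrib] at h1
        have h2 : ∑ k ∈ s, y k * (a k v₀ / α * a m v) = (∑ k ∈ s, y k * (a k v₀ / α)) * a m v := by
          rw [Finset.sum_mul]; exact Finset.sum_congr rfl fun k _ => by ring
        have h3 : ∑ k ∈ s, Function.update y m (c v₀ / α - ∑ k ∈ s, y k * (a k v₀ / α)) k * a k v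
            = ∑ k ∈ s, y k * a k v :=
          Finset.sum_congr rfl fun k hk => by
            rw [Function.update_of_ne (ne_of_mem_of_not_mem hk hm)]
        rw [Finset.sum_insert hm, h3, Function.update_self]
        rw [h2] at h1
        linarith

/-- Farkas' lemma for a finite system of linear inequalities and equations. -/
theorem exists_multipliers_of_forall_nonneg {V ι κ : Type*} [AddCommGroup V] [Module ℝ V]
    [Fintype ι] [Fintype κ] (a : ι → V →ₗ[ℝ] ℝ) (e : κ → V →ₗ[ℝ] ℝ) (c : V →ₗ[ℝ] ℝ)
    (h : ∀ v, (∀ k, 0 ≤ a k v) → (∀ k, e k v = 0) → 0 ≤ c v) :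
    ∃ (y : ι → ℝ) (ξ : κ → ℝ), (∀ k, 0 ≤ y k) ∧
      ∀ v, c v = ∑ k, y k * a k v + ∑ k, ξ k * e k v := by
  obtain ⟨y, hy, hc⟩ := exists_nonneg_combination_of_forall_nonpos
    (Finset.univ : Finset (ι ⊕ (κ ⊕ κ))) (Sum.elim (fun k => -a k) (Sum.elim (fun k => -e k) e))
    (-c) (fun v hv => by
      have h1 := h v (fun k => by simpa using hv (Sum.inl k) (Finset.mem_univ _)) (fun k => by
        have h1 := hv (Sum.inr (Sum.inl k)) (Finset.mem_univ _)
        have h2 := hv (Sum.inr (Sum.inr k)) (Finset.mem_univ _)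
        simp only [Sum.elim_inr, Sum.elim_inl, LinearMap.neg_apply] at h1 h2
        linarith)
      simpa using h1)
  refine ⟨fun k => y (Sum.inl k), fun k => y (Sum.inr (Sum.inl k)) - y (Sum.inr (Sum.inr k)),
    fun k => hy _ (Finset.mem_univ _), fun v => ?_⟩
  have := hc v
  simp only [Fintype.sum_sum_type, Sum.elim_inl, Sum.elim_inr, LinearMap.neg_apply, mul_neg,
    Finset.sum_neg_distrib] at this
  simp only [sub_mul, Finset.sum_sub_distrib]
  linarith

/-- A lower bound for a separable function on a product splits into lower bounds of the summands. -/
theorem exists_lower_bounds_of_sum {ι : Type*} [Fintype ι] {α : ι → Type*} (S : ∀ i, Set (α i))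
    (hS : ∀ i, (S i).Nonempty) (φ : ∀ i, α i → ℝ) (P : ℝ)
    (h : ∀ v : ∀ i, α i, (∀ i, v i ∈ S i) → P ≤ ∑ i, φ i (v i)) :
    ∃ a : ι → ℝ, P ≤ ∑ i, a i ∧ ∀ i, ∀ v ∈ S i, a i ≤ φ i v := by
  classical
  choose v₀ hv₀ using hS
  have hbdd : ∀ i, BddBelow (φ i '' S i) := by
    intro i
    refine ⟨P - ∑ k ∈ Finset.univ.erase i, φ k (v₀ k), ?_⟩
    rintro _ ⟨v, hv, rfl⟩
    have := h (Function.update v₀ i v) (fun k => by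
      by_cases hk : k = i
      · subst hk; simpa using hv
      · simpa [hk] using hv₀ k)
    rw [← Finset.add_sum_erase _ _ (Finset.mem_univ i)] at this
    have h2 : ∑ k ∈ Finset.univ.erase i, φ k (Function.update v₀ i v k)
        = ∑ k ∈ Finset.univ.erase i, φ k (v₀ k) :=
      Finset.sum_congr rfl fun k hk => by rw [Function.update_of_ne (Finset.ne_of_mem_erase hk)]
    rw [h2, Function.update_self] at this
    linarith
  refine ⟨fun i => sInf (φ i '' S i), ?_, fun i v hv => csInf_le (hbdd i) ⟨v, hv, rfl⟩⟩
  refine le_of_forall_pos_le_add fun δ hδ => ?_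
  -- The added one also covers an empty index type.
  have hpos : 0 < δ / (Fintype.card ι + 1) := by positivity
  have : ∀ i, ∃ v ∈ S i, φ i v < sInf (φ i '' S i) + δ / (Fintype.card ι + 1) := by
    intro i
    obtain ⟨_, ⟨v, hv, rfl⟩, hlt⟩ := exists_lt_of_csInf_lt (⟨_, v₀ i, hv₀ i, rfl⟩ :
      (φ i '' S i).Nonempty) (lt_add_of_pos_right _ hpos)
    exact ⟨v, hv, hlt⟩
  choose v hv hlt using this
  refine (h v hv).trans ((Finset.sum_le_sum fun i _ => (hlt i).le).trans ?_)
  rw [Finset.sum_add_distrib, Finset.sum_const, Finset.card_univ, nsmul_eq_mul]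
  have : (Fintype.card ι : ℝ) * (δ / (Fintype.card ι + 1)) ≤ δ := by
    rw [mul_div_assoc', div_le_iff₀ (by positivity)]
    nlinarith
  linarith

/-! ### Multipliers for nonanticipativity. -/

section Multipliers

variable {I J K L M N : ℕ} (D : Data I J K L M N)

/-- Linear programming duality in which only the constraints `x_i = E[x]` are relaxed. The system is
made homogeneous by an extra variable `s ≥ 0` multiplying the right-hand sides, so that Farkas'
lemma for linear functionals applies; its multipliers for `x_i = E[x]`, suitably centered, are the
`λ`. -/
theorem exists_nonanticipativity_multiplier (hX' : (feasibleSet D).Nonempty)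
    (c : Fin I → (Fin M → ℝ) × (Fin N → ℝ) →ₗ[ℝ] ℝ) (P : ℝ)
    (h : ∀ v ∈ feasibleSet D, P ≤ ∑ i, c i (v.1, v.2 i)) :
    ∃ lam : Fin I → Fin M → ℝ, MeanZero D lam ∧
      ∀ v : Fin I → (Fin M → ℝ) × (Fin N → ℝ), (∀ i, v i ∈ scenarioSet D i) →
        P ≤ ∑ i, (c i (v i) + D.p i * (lam i ⬝ᵥ (v i).1)) := by
  let ax : Fin I × Fin M → (Fin I → (Fin M → ℝ) × (Fin N → ℝ)) × ℝ →ₗ[ℝ] ℝ := fun k =>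
    { toFun := fun v => (v.1 k.1).1 k.2, map_add' := fun _ _ => rfl, map_smul' := fun _ _ => rfl }
  let ay : Fin I × Fin N → (Fin I → (Fin M → ℝ) × (Fin N → ℝ)) × ℝ →ₗ[ℝ] ℝ := fun k =>
    { toFun := fun v => (v.1 k.1).2 k.2, map_add' := fun _ _ => rfl, map_smul' := fun _ _ => rfl }
  let eA : Fin I × Fin K → (Fin I → (Fin M → ℝ) × (Fin N → ℝ)) × ℝ →ₗ[ℝ] ℝ := fun k =>
    { toFun := fun v => (D.A *ᵥ (v.1 k.1).1) k.2 - v.2 * D.b k.2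
      map_add' := fun v v' => by simp [Matrix.mulVec_add]; ring
      map_smul' := fun s v => by simp [Matrix.mulVec_smul]; ring }
  let eT : Fin I × Fin L → (Fin I → (Fin M → ℝ) × (Fin N → ℝ)) × ℝ →ₗ[ℝ] ℝ := fun k =>
    { toFun := fun v => (D.T k.1 *ᵥ (v.1 k.1).1 + D.W k.1 *ᵥ (v.1 k.1).2) k.2 - v.2 * D.h k.1 k.2
      map_add' := fun v v' => by simp [Matrix.mulVec_add]; ring
      map_smul' := fun s v => by simp [Matrix.mulVec_smul]; ring }
  let eN : Fin I × Fin M → (Fin I → (Fin M → ℝ) × (Fin N → ℝ)) × ℝ →ₗ[ℝ] ℝ := fun k =>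
    { toFun := fun v => (v.1 k.1).1 k.2 - ∑ i, D.p i * (v.1 i).1 k.2
      map_add' := fun v v' => by
        simp [mul_add, Finset.sum_add_distrib]; ring
      map_smul' := fun s v => by
        simp only [Prod.smul_fst, Pi.smul_apply, smul_eq_mul, RingHom.id_apply, mul_sub,
          Finset.mul_sum]
        congr 1
        exact Finset.sum_congr rfl fun i _ => by ring }
  let obj : (Fin I → (Fin M → ℝ) × (Fin N → ℝ)) × ℝ →ₗ[ℝ] ℝ :=
    { toFun := fun v => ∑ i, c i (v.1 i) - v.2 * P
      map_add' := fun v v' => by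
        simp [Finset.sum_add_distrib]; ring
      map_smul' := fun s v => by
        simp [Finset.mul_sum, mul_sub]; ring }
  let at' : Unit → (Fin I → (Fin M → ℝ) × (Fin N → ℝ)) × ℝ →ₗ[ℝ] ℝ := fun _ => LinearMap.snd ℝ _ _
  obtain ⟨x₀, hx₀, hy₀, hA₀, hT₀⟩ := hX'
  obtain ⟨y, ξ, hy, hobj⟩ := exists_multipliers_of_forall_nonneg
    (Sum.elim ax (Sum.elim ay at')) (Sum.elim eA (Sum.elim eT eN)) obj (by
    rintro ⟨v, s⟩ ha he
    have hvx : ∀ i m, 0 ≤ (v i).1 m := fun i m => ha (Sum.inl (i, m))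
    have hvy : ∀ i m, 0 ≤ (v i).2 m := fun i m => ha (Sum.inr (Sum.inl (i, m)))
    have hs : 0 ≤ s := ha (Sum.inr (Sum.inr ()))
    have hvA : ∀ i k, (D.A *ᵥ (v i).1) k = s * D.b k := fun i k =>
      sub_eq_zero.1 (he (Sum.inl (i, k)))
    have hvT : ∀ i k, (D.T i *ᵥ (v i).1 + D.W i *ᵥ (v i).2) k = s * D.h i k := fun i k =>
      sub_eq_zero.1 (he (Sum.inr (Sum.inl (i, k))))
    have hvN : ∀ i m, (v i).1 m = ∑ k, D.p k * (v k).1 m := fun i m =>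
      sub_eq_zero.1 (he (Sum.inr (Sum.inr (i, m))))
    set xb : Fin M → ℝ := fun m => ∑ k, D.p k * (v k).1 m with hxb
    have hvx' : ∀ i, (v i).1 = xb := fun i => funext (hvN i)
    have hI : Nonempty (Fin I) := by
      by_contra hne
      rw [not_nonempty_iff] at hne
      simpa using D.p_sum
    obtain ⟨i₀⟩ := hI
    have hxb0 : 0 ≤ xb := by rw [← hvx' i₀]; exact hvx i₀
    have hxbA : D.A *ᵥ xb = s • D.b := by rw [← hvx' i₀]; exact funext (hvA i₀)
    have hxbT : ∀ i, D.T i *ᵥ xb + D.W i *ᵥ (v i).2 = s • D.h i := fun i => by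
      rw [← hvx' i]; exact funext (hvT i)
    have hvi : ∀ i, v i = (xb, (v i).2) := fun i => Prod.ext (hvx' i) rfl
    change 0 ≤ ∑ i, c i (v i) - s * P
    -- For `s = 0` the vector is a recession direction of the feasible set; a negative cost along it
    -- would push the objective below `P`. For `s > 0`, rescaling gives a feasible point.
    rcases hs.eq_or_lt with rfl | hs
    · rw [zero_mul, sub_zero]
      by_contra hneg
      push Not at hneg
      set S := ∑ i, c i (v i)
      have key : ∀ r : ℝ, 0 ≤ r → P ≤ ∑ i, c i (x₀.1, x₀.2 i) + r * S := by
        intro r hr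
        have := h (x₀.1 + r • xb, fun i => x₀.2 i + r • (v i).2) ⟨?_, ?_, ?_, ?_⟩
        · refine this.trans (le_of_eq ?_)
          rw [Finset.mul_sum, ← Finset.sum_add_distrib]
          refine Finset.sum_congr rfl fun i _ => ?_
          rw [hvi i, ← smul_eq_mul, ← map_smul, ← map_add]
          rfl
        · exact add_nonneg hx₀ (smul_nonneg hr hxb0)
        · exact fun i => add_nonneg (hy₀ i) (smul_nonneg hr (hvy i))
        · simp only [Matrix.mulVec_add, Matrix.mulVec_smul, hxbA, hA₀, zero_smul, smul_zero,
            add_zero]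
        · intro i
          have h1 := hxbT i
          have h2 := hT₀ i
          simp only [Matrix.mulVec_add, Matrix.mulVec_smul]
          calc _ = (D.T i *ᵥ x₀.1 + D.W i *ᵥ x₀.2 i)
                + r • (D.T i *ᵥ xb + D.W i *ᵥ (v i).2) := by rw [smul_add]; abel
            _ = D.h i := by rw [h1, h2, zero_smul, smul_zero, add_zero]
      set Z := ∑ i, c i (x₀.1, x₀.2 i)
      have h1 := key ((|Z - P| + 1) / (-S)) (by have := neg_pos.2 hneg; positivity)
      have h2 : (|Z - P| + 1) / (-S) * S = -(|Z - P| + 1) := by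
        rw [div_neg, neg_mul, div_mul_cancel₀ _ hneg.ne]
      have := le_abs_self (Z - P)
      linarith
    · have := h (s⁻¹ • xb, fun i => s⁻¹ • (v i).2) ⟨?_, ?_, ?_, ?_⟩
      · have h2 : ∑ i, c i (s⁻¹ • xb, s⁻¹ • (v i).2) = s⁻¹ * ∑ i, c i (v i) := by
          rw [Finset.mul_sum]
          refine Finset.sum_congr rfl fun i _ => ?_
          conv_rhs => rw [hvi i, ← smul_eq_mul, ← map_smul]
          rfl
        have h3 := mul_le_mul_of_nonneg_left (this.trans h2.le) hs.le
        rw [mul_inv_cancel_left₀ hs.ne'] at h3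
        linarith
      · exact smul_nonneg (inv_nonneg.2 hs.le) hxb0
      · exact fun i => smul_nonneg (inv_nonneg.2 hs.le) (hvy i)
      · simp only [Matrix.mulVec_smul, hxbA, smul_smul, inv_mul_cancel₀ hs.ne', one_smul]
      · intro i
        simp only [Matrix.mulVec_smul]
        rw [← smul_add, hxbT, smul_smul, inv_mul_cancel₀ hs.ne', one_smul])
  let ζ : Fin I → Fin M → ℝ := fun i m => ξ (Sum.inr (Sum.inr (i, m)))
  -- Subtracting `p_i ∑ k, ζ k` makes the mean zero, and it is also what `ζ_i ⬝ (x_i - E[x])`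
  -- produces when the terms in each `x_i` are collected.
  refine ⟨fun i m => -(ζ i m - D.p i * ∑ k, ζ k m) / D.p i, ?_, fun v hv => ?_⟩
  · funext m
    simp only [Finset.sum_apply, Pi.smul_apply, smul_eq_mul, Pi.zero_apply]
    have : ∀ i, D.p i * (-(ζ i m - D.p i * ∑ k, ζ k m) / D.p i)
        = D.p i * (∑ k, ζ k m) - ζ i m := fun i => by
      have := (D.p_pos i).ne'
      field_simp
      ring
    simp only [this, Finset.sum_sub_distrib, ← Finset.sum_mul, D.p_sum, one_mul, sub_self]
  · have h1 := hobj (v, 1)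
    have h2 : 0 ≤ ∑ k, y k * (Sum.elim ax (Sum.elim ay at') k) (v, 1) := by
      refine Finset.sum_nonneg fun k _ => mul_nonneg (hy k) ?_
      rcases k with k | k | k
      · exact (hv k.1).1 k.2
      · exact (hv k.1).2.1 k.2
      · exact zero_le_one
    have hA : ∀ k, eA k (v, 1) = 0 := fun k => by
      change (D.A *ᵥ (v k.1).1) k.2 - 1 * D.b k.2 = 0
      rw [(hv k.1).2.2.1]; ring
    have hT : ∀ k, eT k (v, 1) = 0 := fun k => by
      change (D.T k.1 *ᵥ (v k.1).1 + D.W k.1 *ᵥ (v k.1).2) k.2 - 1 * D.h k.1 k.2 = 0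
      rw [(hv k.1).2.2.2]; ring
    have h3 : ∑ k, ξ k * (Sum.elim eA (Sum.elim eT eN) k) (v, 1)
        = ∑ i, ∑ m, ζ i m * ((v i).1 m - ∑ k, D.p k * (v k).1 m) := by
      simp only [Fintype.sum_sum_type, Sum.elim_inl, Sum.elim_inr, hA, hT, mul_zero,
        Finset.sum_const_zero, zero_add]
      rw [Fintype.sum_prod_type]
      rfl
    have h4 : ∑ i, D.p i * ((fun m => -(ζ i m - D.p i * ∑ k, ζ k m) / D.p i) ⬝ᵥ (v i).1)
        = -∑ i, ∑ m, ζ i m * ((v i).1 m - ∑ k, D.p k * (v k).1 m) := by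
      have h5 : ∀ i, D.p i * ((fun m => -(ζ i m - D.p i * ∑ k, ζ k m) / D.p i) ⬝ᵥ (v i).1)
          = ∑ m, ((D.p i * (v i).1 m) * ∑ k, ζ k m) - ∑ m, ζ i m * (v i).1 m := fun i => by
        rw [dotProduct, Finset.mul_sum, ← Finset.sum_sub_distrib]
        refine Finset.sum_congr rfl fun m _ => ?_
        have := (D.p_pos i).ne'
        field_simp
        ring
      rw [Finset.sum_congr rfl fun i _ => h5 i]
      simp only [mul_sub, Finset.sum_sub_distrib, neg_sub]
      congr 1
      rw [Finset.sum_comm, Finset.sum_comm (f := fun i m => ζ i m * _)]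
      refine Finset.sum_congr rfl fun m _ => ?_
      rw [← Finset.sum_mul, ← Finset.sum_mul, mul_comm]
    rw [Finset.sum_add_distrib, h4]
    have h6 : obj (v, 1) = ∑ i, c i (v i) - 1 * P := rfl
    rw [h3, h6] at h1
    linarith

end Multipliers

/-! ### Probability vectors and acceptance sets. -/

theorem weightedExp_eq_sum {I J : ℕ} (w : Fin J → ℝ) (μ u : Fin I → Fin J → ℝ) :
    weightedExp w μ u = ∑ i, w ⬝ᵥ (μ i * u i) := by
  rw [weightedExp, dotProduct_sum]

theorem weightedExp_eq_sum_sum {I J : ℕ} (w : Fin J → ℝ) (μ u : Fin I → Fin J → ℝ) :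
    weightedExp w μ u = ∑ i, ∑ j, w j * (μ i j * u i j) := by
  rw [weightedExp_eq_sum]; rfl

theorem probVectors_le_one {I J : ℕ} {μ : Fin I → Fin J → ℝ} (hμ : μ ∈ probVectors I J)
    (i : Fin I) (j : Fin J) : μ i j ≤ 1 := by
  have := Finset.single_le_sum (fun k _ => hμ.1 k j) (Finset.mem_univ i)
  rwa [hμ.2 j] at this

theorem isCompact_probVectors (I J : ℕ) : IsCompact (probVectors I J) := by
  refine IsCompact.of_isClosed_subset (isCompact_Icc (a := (0 : Fin I → Fin J → ℝ)) (b := 1)) ?_ ?_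
  · have : probVectors I J = (⋂ i, ⋂ j, {μ | 0 ≤ μ i j}) ∩ ⋂ j, {μ | ∑ i, μ i j = 1} := by
      ext μ; simp [probVectors]
    rw [this]
    refine IsClosed.inter (isClosed_iInter fun i => isClosed_iInter fun j => ?_)
      (isClosed_iInter fun j => ?_)
    · exact isClosed_le continuous_const (by fun_prop)
    · exact isClosed_eq (by fun_prop) continuous_const
  · exact fun μ hμ => ⟨fun i j => hμ.1 i j, fun i j => probVectors_le_one hμ i j⟩

theorem IsConvexRiskMeasure.mem_iff {I J : ℕ} {R : (Fin I → Fin J → ℝ) → Set (Fin J → ℝ)}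
    (hR : IsConvexRiskMeasure R) (u : Fin I → Fin J → ℝ) (z : Fin J → ℝ) :
    z ∈ R u ↔ 0 ∈ R (fun i => u i - z) := by
  have h := hR.translative u (-z)
  simp only [← sub_eq_add_neg] at h
  rw [h]
  constructor
  · exact fun hz => ⟨z, hz, sub_self z⟩
  · rintro ⟨r, hr, h0⟩
    have : r = z := sub_eq_zero.1 h0
    exact this ▸ hr

/-- Monotonicity and translativity combined: costs that grow by at most `r` are covered by `r` more
capital. All perturbations of costs below go through this. -/
theorem IsConvexRiskMeasure.mem_add {I J : ℕ} {R : (Fin I → Fin J → ℝ) → Set (Fin J → ℝ)}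
    (hR : IsConvexRiskMeasure R) {u v : Fin I → Fin J → ℝ} {z r : Fin J → ℝ}
    (hz : z ∈ R u) (h : ∀ i j, v i j ≤ u i j + r j) : z + r ∈ R v := by
  refine hR.monotone v (fun i => u i + r) (fun i j => h i j) ?_
  rw [hR.translative]
  exact ⟨z, hz, rfl⟩

theorem IsConvexRiskMeasure.acceptance_nonempty {I J : ℕ}
    {R : (Fin I → Fin J → ℝ) → Set (Fin J → ℝ)} (hR : IsConvexRiskMeasure R) :
    ∃ u, 0 ∈ R u := by
  obtain ⟨r, hr⟩ := Set.nonempty_iff_ne_empty.2 (hR.finite 0).1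
  exact ⟨_, (hR.mem_iff 0 r).1 hr⟩

/-! ### Weak duality and existence of a dual optimal point. -/

section DualBound

variable {I J K L M N : ℕ} (D : Data I J K L M N)
  (R : (Fin I → Fin J → ℝ) → Set (Fin J → ℝ)) (w : Fin J → ℝ)

/-- `a i` is a lower bound of `f_i(μ_i, λ_i, w)` and `b` is an upper bound of `β(μ, w)` at the
dual feasible point `(μ, λ)`; thus `∑ i, a i - b` is a lower bound of the dual objective. -/
structure IsDualBound (μ : Fin I → Fin J → ℝ) (lam : Fin I → Fin M → ℝ) (a : Fin I → ℝ) (b : ℝ) :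
    Prop where
  mem : μ ∈ probVectors I J
  mean : MeanZero D lam
  le_sub : ∀ i, ∀ v ∈ scenarioSet D i, a i ≤ subObjective D w i (μ i) (lam i) v
  le_pen : ∀ u, 0 ∈ R u → weightedExp w μ u ≤ b

theorem sum_subObjective (μ : Fin I → Fin J → ℝ) (lam : Fin I → Fin M → ℝ)
    (x : Fin I → Fin M → ℝ) (y : Fin I → Fin N → ℝ) :
    ∑ i, subObjective D w i (μ i) (lam i) (x i, y i)
      = weightedExp w μ (totalCost D x y) + ∑ i, D.p i * (lam i ⬝ᵥ x i) := by
  rw [weightedExp_eq_sum, ← Finset.sum_add_distrib]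
  rfl

variable {D R w}

theorem MeanZero.sum_dotProduct {lam : Fin I → Fin M → ℝ} (h : MeanZero D lam) (x : Fin M → ℝ) :
    ∑ i, D.p i * (lam i ⬝ᵥ x) = 0 := by
  have : ∑ i, D.p i * (lam i ⬝ᵥ x) = (∑ i, D.p i • lam i) ⬝ᵥ x := by
    rw [_root_.sum_dotProduct]
    exact Finset.sum_congr rfl fun i _ => by rw [smul_dotProduct, smul_eq_mul]
  rw [this, h, zero_dotProduct]

theorem IsDualBound.sum_le {μ : Fin I → Fin J → ℝ} {lam : Fin I → Fin M → ℝ} {a : Fin I → ℝ}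
    {b : ℝ} (h : IsDualBound D R w μ lam a b) {v : (Fin M → ℝ) × (Fin I → Fin N → ℝ)}
    (hv : v ∈ feasibleSet D) :
    ∑ i, a i ≤ weightedExp w μ (totalCost D (fun _ => v.1) v.2) := by
  have h1 : ∑ i, a i ≤ ∑ i, subObjective D w i (μ i) (lam i) (v.1, v.2 i) :=
    Finset.sum_le_sum fun i _ => h.le_sub i _ ⟨hv.1, hv.2.1 i, hv.2.2.1, hv.2.2.2 i⟩
  have h2 := sum_subObjective D w μ lam (fun _ => v.1) v.2
  rw [h.mean.sum_dotProduct v.1] at h2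
  linarith

theorem weightedExp_sub_const {μ : Fin I → Fin J → ℝ} (hμ : μ ∈ probVectors I J)
    (u : Fin I → Fin J → ℝ) (z : Fin J → ℝ) :
    weightedExp w μ (fun i => u i - z) = weightedExp w μ u - w ⬝ᵥ z := by
  have : w ⬝ᵥ z = ∑ i, ∑ j, w j * (μ i j * z j) := by
    rw [Finset.sum_comm]
    refine Finset.sum_congr rfl fun j _ => ?_
    rw [← Finset.mul_sum, ← Finset.sum_mul, hμ.2 j, one_mul]
  rw [weightedExp_eq_sum_sum, weightedExp_eq_sum_sum, this, ← Finset.sum_sub_distrib]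
  refine Finset.sum_congr rfl fun i _ => ?_
  rw [← Finset.sum_sub_distrib]
  exact Finset.sum_congr rfl fun j _ => by rw [Pi.sub_apply]; ring

/-- Weak duality. -/
theorem IsDualBound.le_dotProduct {μ : Fin I → Fin J → ℝ} {lam : Fin I → Fin M → ℝ}
    {a : Fin I → ℝ} {b : ℝ} (hR : IsConvexRiskMeasure R) (h : IsDualBound D R w μ lam a b)
    {v : (Fin M → ℝ) × (Fin I → Fin N → ℝ)}
    (hv : v ∈ feasibleSet D) {z : Fin J → ℝ} (hz : z ∈ R (totalCost D (fun _ => v.1) v.2)) :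
    ∑ i, a i - b ≤ w ⬝ᵥ z := by
  have h1 := h.le_pen _ ((hR.mem_iff _ _).1 hz)
  rw [weightedExp_sub_const h.mem] at h1
  have := h.sum_le hv
  linarith

/-- If the dual problem has a feasible point, then it has an optimal one. -/
theorem exists_isDualBound_max (hX' : (feasibleSet D).Nonempty) (hR : IsConvexRiskMeasure R)
    (h : ∃ μ lam a b, IsDualBound D R w μ lam a b) :
    ∃ μ lam a b, IsDualBound D R w μ lam a b ∧ ∀ μ' lam' a' b',
      IsDualBound D R w μ' lam' a' b' → ∑ i, a' i - b' ≤ ∑ i, a i - b := by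
  obtain ⟨μ₁, lam₁, a₁, b₁, h₁⟩ := h
  let A : Set (((Fin M → ℝ) × (Fin I → Fin N → ℝ)) × (Fin I → Fin J → ℝ)) :=
    feasibleSet D ×ˢ {u | 0 ∈ R u}
  let g : (((Fin M → ℝ) × (Fin I → Fin N → ℝ)) × (Fin I → Fin J → ℝ)) → (Fin I → Fin J → ℝ) → ℝ :=
    fun q μ => weightedExp w μ (totalCost D (fun _ => q.1.1) q.1.2) - weightedExp w μ q.2
  -- The dual objective with `λ` already maximized out. As an infimum of functions continuous in `μ`
  -- it is upper semicontinuous, so it attains its maximum on the compact set of probability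
  -- vectors; no compactness in `λ` is needed.
  let H : (Fin I → Fin J → ℝ) → EReal := fun μ => ⨅ q ∈ A, ((g q μ : ℝ) : EReal)
  have hg : ∀ q, Continuous (g q) := fun q => by
    simp only [g, weightedExp_eq_sum_sum]
    fun_prop
  have hH : UpperSemicontinuousOn H (probVectors I J) :=
    upperSemicontinuousOn_biInf fun q _ =>
      ((continuous_coe_real_ereal.comp (hg q)).upperSemicontinuous).upperSemicontinuousOn _
  have hle : ∀ μ lam a b, IsDualBound D R w μ lam a b → ((∑ i, a i - b : ℝ) : EReal) ≤ H μ := by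
    intro μ lam a b hb
    refine le_iInf₂ fun q hq => EReal.coe_le_coe_iff.2 ?_
    exact sub_le_sub (hb.sum_le hq.1) (hb.le_pen _ hq.2)
  obtain ⟨μ, hμ, hmax⟩ := hH.exists_isMaxOn ⟨μ₁, h₁.mem⟩ (isCompact_probVectors I J)
  obtain ⟨v₀, hv₀⟩ := hX'
  obtain ⟨u₀, hu₀⟩ := hR.acceptance_nonempty
  have hbot : H μ ≠ ⊥ := by
    have h1 := (hle _ _ _ _ h₁).trans (hmax h₁.mem)
    intro h2
    rw [h2, le_bot_iff] at h1
    exact EReal.coe_ne_bot _ h1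
  have htop : H μ ≠ ⊤ := by
    intro h2
    have h1 : H μ ≤ ((g (v₀, u₀) μ : ℝ) : EReal) := iInf₂_le (v₀, u₀) ⟨hv₀, hu₀⟩
    rw [h2, top_le_iff] at h1
    exact EReal.coe_ne_top _ h1
  obtain ⟨s, hs⟩ : ∃ s : ℝ, (s : EReal) = H μ := ⟨(H μ).toReal, EReal.coe_toReal htop hbot⟩
  have hsle : ∀ v ∈ feasibleSet D, ∀ u, 0 ∈ R u →
      s + weightedExp w μ u ≤ weightedExp w μ (totalCost D (fun _ => v.1) v.2) := by
    intro v hv u hu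
    have h1 : H μ ≤ ((g (v, u) μ : ℝ) : EReal) := iInf₂_le (v, u) ⟨hv, hu⟩
    rw [← hs, EReal.coe_le_coe_iff] at h1
    simp only [g] at h1
    linarith
  set B := (weightedExp w μ) '' {u | 0 ∈ R u}
  have hBne : B.Nonempty := ⟨_, u₀, hu₀, rfl⟩
  have hBbdd : BddAbove B := by
    refine ⟨weightedExp w μ (totalCost D (fun _ => v₀.1) v₀.2) - s, ?_⟩
    rintro _ ⟨u, hu, rfl⟩
    have := hsle v₀ hv₀ u hu
    linarith
  let c : Fin I → (Fin M → ℝ) × (Fin N → ℝ) →ₗ[ℝ] ℝ := fun i =>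
    { toFun := fun v => w ⬝ᵥ (μ i * scenarioCost D i v.1 v.2)
      map_add' := fun v v' => by
        rw [← dotProduct_add, ← mul_add]
        simp only [scenarioCost, Prod.fst_add, Prod.snd_add, Matrix.mulVec_add]
        congr 2
        abel
      map_smul' := fun r v => by
        simp only [scenarioCost, Prod.smul_fst, Prod.smul_snd, Matrix.mulVec_smul, ← smul_add,
          mul_smul_comm, dotProduct_smul, RingHom.id_apply] }
  -- At the maximizing `μ`, the finite number `s + sSup B` bounds the linear cost on the feasible
  -- set from below; its multiplier is the optimal `λ`.
  obtain ⟨lam, hlam, hP⟩ := exists_nonanticipativity_multiplier D ⟨v₀, hv₀⟩ c (s + sSup B) (by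
    intro v hv
    have : sSup B ≤ weightedExp w μ (totalCost D (fun _ => v.1) v.2) - s := by
      refine csSup_le hBne ?_
      rintro _ ⟨u, hu, rfl⟩
      have := hsle v hv u hu
      linarith
    have h2 : ∑ i, c i (v.1, v.2 i) = weightedExp w μ (totalCost D (fun _ => v.1) v.2) := by
      rw [weightedExp_eq_sum]; rfl
    rw [h2]
    linarith)
  obtain ⟨a, ha, hac⟩ := exists_lower_bounds_of_sum (fun i => scenarioSet D i)
    (fun i => ⟨(v₀.1, v₀.2 i), hv₀.1, hv₀.2.1 i, hv₀.2.2.1, hv₀.2.2.2 i⟩)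
    (fun i v => c i v + D.p i * (lam i ⬝ᵥ v.1)) (s + sSup B) hP
  refine ⟨μ, lam, a, sSup B, ⟨hμ, hlam, hac, fun u hu => le_csSup hBbdd ⟨u, hu, rfl⟩⟩, ?_⟩
  intro μ' lam' a' b' h'
  have h1 := (hle _ _ _ _ h').trans (hmax h'.mem)
  rw [← hs, EReal.coe_le_coe_iff] at h1
  linarith

end DualBound

/-! ### Nearly nonanticipative decisions. -/

section Perturbation

variable {I J K L M N : ℕ} (D : Data I J K L M N)

theorem nonempty_scenarios (D : Data I J K L M N) : Nonempty (Fin I) := by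
  by_contra hne
  rw [not_nonempty_iff] at hne
  simpa using D.p_sum

theorem isClosed_scenarioSet (i : Fin I) : IsClosed (scenarioSet D i) := by
  have h1 : Continuous fun v : (Fin M → ℝ) × (Fin N → ℝ) => D.A *ᵥ v.1 :=
    (Matrix.mulVecLin D.A).continuous_of_finiteDimensional.comp continuous_fst
  have h2 : Continuous fun v : (Fin M → ℝ) × (Fin N → ℝ) => D.T i *ᵥ v.1 + D.W i *ᵥ v.2 :=
    ((Matrix.mulVecLin (D.T i)).continuous_of_finiteDimensional.comp continuous_fst).add
      ((Matrix.mulVecLin (D.W i)).continuous_of_finiteDimensional.comp continuous_snd)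
  exact (isClosed_le continuous_const continuous_fst).inter
    ((isClosed_le continuous_const continuous_snd).inter
      ((isClosed_eq h1 continuous_const).inter (isClosed_eq h2 continuous_const)))

theorem convex_scenarioSet (i : Fin I) : Convex ℝ (scenarioSet D i) := by
  rintro v ⟨h1, h2, h3, h4⟩ v' ⟨h1', h2', h3', h4'⟩ a b ha hb hab
  refine ⟨add_nonneg (smul_nonneg ha h1) (smul_nonneg hb h1'),
    add_nonneg (smul_nonneg ha h2) (smul_nonneg hb h2'), ?_, ?_⟩
  · simp only [Prod.fst_add, Prod.smul_fst, Matrix.mulVec_add, Matrix.mulVec_smul, h3, h3']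
    rw [← add_smul, hab, one_smul]
  · simp only [Prod.fst_add, Prod.smul_fst, Prod.snd_add, Prod.smul_snd, Matrix.mulVec_add,
      Matrix.mulVec_smul]
    calc _ = a • (D.T i *ᵥ v.1 + D.W i *ᵥ v.2) + b • (D.T i *ᵥ v'.1 + D.W i *ᵥ v'.2) := by
          rw [smul_add, smul_add]; abel
      _ = D.h i := by rw [h4, h4', ← add_smul, hab, one_smul]

/-- Scenariowise feasible decisions that are nearly nonanticipative have nearly the same costs as
some feasible decision. -/
theorem exists_feasible_cost_near (hX : IsCompact (feasibleSet D))
    (hX' : (feasibleSet D).Nonempty) {δ : ℝ} (hδ : 0 < δ) :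
    ∃ η : ℝ, 0 < η ∧ ∀ (x : Fin I → Fin M → ℝ) (y : Fin I → Fin N → ℝ) (σ : Fin M → ℝ),
      (∀ i, (x i, y i) ∈ scenarioSet D i) → (∀ i, ‖x i - σ‖ < η) →
        ∃ v ∈ feasibleSet D, ∀ i j,
          |totalCost D (fun _ => v.1) v.2 i j - totalCost D x y i j| < δ := by
  obtain ⟨i₀⟩ := nonempty_scenarios D
  let cost : (Fin I → Fin M → ℝ) × (Fin I → Fin N → ℝ) →ₗ[ℝ] (Fin I → Fin J → ℝ) :=
    { toFun := fun q => totalCost D q.1 q.2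
      map_add' := fun q q' => by
        funext i
        simp only [totalCost, scenarioCost, Prod.fst_add, Prod.snd_add, Pi.add_apply,
          Matrix.mulVec_add]
        abel
      map_smul' := fun r q => by
        funext i
        simp only [totalCost, scenarioCost, Prod.smul_fst, Prod.smul_snd, Pi.smul_apply,
          Matrix.mulVec_smul, RingHom.id_apply, smul_add] }
  set T := LinearMap.toContinuousLinearMap cost
  set δ' := δ / (‖T‖ + 1)
  have hδ' : 0 < δ' := by positivity
  have hTδ : ‖T‖ * δ' < δ := by
    rw [mul_div_assoc', div_lt_iff₀ (by positivity)]
    nlinarith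
  let Z : Set ((Fin I → Fin M → ℝ) × (Fin I → Fin N → ℝ)) :=
    {q | ∀ i, (q.1 i, q.2 i) ∈ scenarioSet D i}
  let emb : (Fin M → ℝ) × (Fin I → Fin N → ℝ) → (Fin I → Fin M → ℝ) × (Fin I → Fin N → ℝ) :=
    fun v => (fun _ => v.1, v.2)
  have hemb : Continuous emb := by fun_prop
  set X := emb '' feasibleSet D with hXdef
  have hXc : IsCompact X := hX.image hemb
  have hXne : X.Nonempty := hX'.image emb
  have hXmem : ∀ q ∈ Z, (∀ i k, q.1 i = q.1 k) → q ∈ X := by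
    intro q hq he
    refine ⟨(q.1 i₀, q.2), ⟨(hq i₀).1, fun i => (hq i).2.1, (hq i₀).2.2.1, fun i => ?_⟩, ?_⟩
    · change D.T i *ᵥ q.1 i₀ + _ = _
      rw [he i₀ i]
      exact (hq i).2.2.2
    · exact Prod.ext (funext fun i => he i₀ i) rfl
  have hXZ : X ⊆ Z := by
    rintro _ ⟨v, hv, rfl⟩ i
    exact ⟨hv.1, hv.2.1 i, hv.2.2.1, hv.2.2.2 i⟩
  have hZc : IsClosed Z := by
    have : Z = ⋂ i, (fun q : (Fin I → Fin M → ℝ) × (Fin I → Fin N → ℝ) => (q.1 i, q.2 i)) ⁻¹'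
        scenarioSet D i := by
      ext q; simp [Z]
    rw [this]
    exact isClosed_iInter fun i => (isClosed_scenarioSet D i).preimage (by fun_prop)
  have hZconv : Convex ℝ Z := fun q hq q' hq' a b ha hb hab i =>
    convex_scenarioSet D i (hq i) (hq' i) ha hb hab
  let d : (Fin I → Fin M → ℝ) × (Fin I → Fin N → ℝ) → ℝ := fun q => ∑ i, ∑ k, ‖q.1 i - q.1 k‖
  have hd : Continuous d := by fun_prop
  have hdnn : ∀ q, 0 ≤ d q := fun q => by positivity
  -- The set `Z` itself need not be bounded, but this shell around the compact set `X` is compact,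
  -- and the disagreement `d` is positive on it.
  set B := Z ∩ {q | Metric.infDist q X = δ'}
  have hBc : IsCompact B := by
    refine hXc.cthickening (r := δ') |>.of_isClosed_subset
      (hZc.inter (isClosed_eq (Metric.continuous_infDist_pt X) continuous_const)) ?_
    intro q hq
    obtain ⟨q', hq', he⟩ := hXc.exists_infDist_eq_dist hXne q
    exact Metric.mem_cthickening_of_dist_le q q' _ _ hq' (by rw [← he]; exact hq.2.le)
  obtain ⟨d₀, hd₀, hdB⟩ : ∃ d₀ : ℝ, 0 < d₀ ∧ ∀ q ∈ B, d₀ ≤ d q := by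
    rcases B.eq_empty_or_nonempty with hB | hB
    · exact ⟨1, one_pos, by simp [hB]⟩
    · obtain ⟨q, hq, hmin⟩ := hBc.exists_isMinOn hB hd.continuousOn
      refine ⟨d q, lt_of_le_of_ne (hdnn q) fun h0 => ?_, hmin⟩
      have hqX : q ∈ X := hXmem q hq.1 fun i k => by
        have h1 := (Finset.sum_eq_zero_iff_of_nonneg (fun i _ => by positivity)).1 h0.symm i
          (Finset.mem_univ i)
        have h2 := (Finset.sum_eq_zero_iff_of_nonneg (fun i _ => by positivity)).1 h1 k
          (Finset.mem_univ k)
        exact sub_eq_zero.1 (norm_eq_zero.1 h2)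
      have := hq.2
      rw [Set.mem_ofPred_eq, Metric.infDist_zero_of_mem hqX] at this
      exact hδ'.ne this
  -- Each of the `I * I` pairwise differences is below twice this number; the added one makes the
  -- total strictly less than `d₀`.
  refine ⟨d₀ / (2 * I * I + 1), by positivity, fun x y σ hxy hσ => ?_⟩
  set q : (Fin I → Fin M → ℝ) × (Fin I → Fin N → ℝ) := (x, y)
  have hqZ : q ∈ Z := hxy
  have hdq : d q < d₀ := by
    have : d q ≤ ∑ i : Fin I, ∑ k : Fin I, 2 * (d₀ / (2 * I * I + 1)) := by
      refine Finset.sum_le_sum fun i _ => Finset.sum_le_sum fun k _ => ?_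
      have h1 := norm_sub_le (x i - σ) (x k - σ)
      rw [sub_sub_sub_cancel_right] at h1
      exact h1.trans (by linarith [hσ i, hσ k])
    refine this.trans_lt ?_
    simp only [Finset.sum_const, Finset.card_univ, Fintype.card_fin, nsmul_eq_mul]
    have : (I : ℝ) * (I * (2 * (d₀ / (2 * I * I + 1)))) = (2 * I * I * d₀) / (2 * I * I + 1) := by
      ring
    rw [this, div_lt_iff₀ (by positivity)]
    nlinarith
  have hdist : Metric.infDist q X ≤ δ' := by
    by_contra hgt
    push Not at hgt
    obtain ⟨q₀, hq₀⟩ := hXne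
    -- A point farther than `δ'` from `X` is joined to `X` by a segment in the convex set `Z` that
    -- crosses the shell. Since `d` vanishes at `q₀`, it does not exceed `d q < d₀` on the segment,
    -- a contradiction.
    let path : ℝ → (Fin I → Fin M → ℝ) × (Fin I → Fin N → ℝ) := fun s => (1 - s) • q₀ + s • q
    have hcont : Continuous fun s => Metric.infDist (path s) X :=
      (Metric.continuous_infDist_pt X).comp (by fun_prop)
    obtain ⟨s, hs, hsδ⟩ := intermediate_value_Icc (zero_le_one (α := ℝ)) hcont.continuousOn
      (show δ' ∈ Set.Icc _ _ from ⟨by simpa [path, Metric.infDist_zero_of_mem hq₀] using hδ'.le,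
        by simpa [path] using hgt.le⟩)
    have h1 : path s ∈ B :=
      ⟨hZconv (hXZ hq₀) hqZ (sub_nonneg.2 hs.2) hs.1 (by ring), hsδ⟩
    have h2 : d (path s) ≤ d q := by
      refine Finset.sum_le_sum fun i _ => Finset.sum_le_sum fun k _ => ?_
      obtain ⟨v, -, rfl⟩ := hq₀
      have : (path s).1 i - (path s).1 k = s • (q.1 i - q.1 k) := by
        simp only [path, emb, Prod.fst_add, Prod.smul_fst, Pi.add_apply, Pi.smul_apply, smul_sub]
        abel
      rw [this, norm_smul, Real.norm_of_nonneg hs.1]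
      exact mul_le_of_le_one_left (norm_nonneg _) hs.2
    linarith [hdB _ h1]
  obtain ⟨_, ⟨v, hv, rfl⟩, he⟩ := hXc.exists_infDist_eq_dist hXne q
  refine ⟨v, hv, fun i j => ?_⟩
  rw [he, dist_comm, dist_eq_norm] at hdist
  have h1 : ‖T (emb v - q)‖ < δ :=
    ((T.le_opNorm _).trans (mul_le_mul_of_nonneg_left hdist (norm_nonneg _))).trans_lt hTδ
  have h2 : T (emb v - q) i j = totalCost D (fun _ => v.1) v.2 i j - totalCost D x y i j := by
    rw [map_sub]; rfl
  rw [← h2, ← Real.norm_eq_abs]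
  exact ((norm_le_pi_norm _ j).trans (norm_le_pi_norm _ i)).trans_lt h1

end Perturbation

/-! ### Supporting probability vectors. -/

/-- A minimizer of `wᵀz` over `R(û)` yields a vector of probability measures at which the dual
representation of the scalarized risk is attained. -/
theorem exists_probVector_of_minimizer {I J : ℕ} [Nonempty (Fin I)]
    {R : (Fin I → Fin J → ℝ) → Set (Fin J → ℝ)} (hR : IsConvexRiskMeasure R) {w : Fin J → ℝ}
    (hw : ∀ j, 0 ≤ w j) (hw' : w ≠ 0) {û : Fin I → Fin J → ℝ} {z : Fin J → ℝ}
    (hz : z ∈ R û) (hmin : ∀ z' ∈ R û, w ⬝ᵥ z ≤ w ⬝ᵥ z') :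
    ∃ μ ∈ probVectors I J, ∀ u, 0 ∈ R u →
      weightedExp w μ u ≤ weightedExp w μ û - w ⬝ᵥ z := by
  -- The costs of strictly smaller scalarized risk form an open convex set that misses `û`. The
  -- separating functional, normalized on constants, is the desired weighted expectation.
  set S : Set (Fin I → Fin J → ℝ) := {u | ∃ r ∈ R u, w ⬝ᵥ r < w ⬝ᵥ z}
  have hSconv : Convex ℝ S := by
    rw [convex_iff_forall_pos]
    rintro u ⟨r, hr, hrz⟩ v ⟨s, hs, hsz⟩ a b ha hb hab
    obtain rfl : b = 1 - a := by linarith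
    refine ⟨a • r + (1 - a) • s, hR.convex u v a ha (by linarith) r hr s hs, ?_⟩
    rw [dotProduct_add, dotProduct_smul, dotProduct_smul, smul_eq_mul, smul_eq_mul]
    nlinarith
  have hSopen : IsOpen S := by
    rw [Metric.isOpen_iff]
    rintro u ⟨r, hr, hrz⟩
    have hW : 0 ≤ ∑ j, w j := Finset.sum_nonneg fun j _ => hw j
    set e := (w ⬝ᵥ z - w ⬝ᵥ r) / (∑ j, w j + 1)
    have he : 0 < e := div_pos (by linarith) (by linarith)
    refine ⟨e, he, fun u' hu' => ⟨r + fun _ => e, hR.mem_add hr fun i j => ?_, ?_⟩⟩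
    · have h1 : dist (u' i j) (u i j) < e :=
        ((dist_le_pi_dist _ _ j).trans (dist_le_pi_dist _ _ i)).trans_lt (Metric.mem_ball.1 hu')
      rw [Real.dist_eq] at h1
      linarith [(abs_lt.1 h1).2]
    · have h1 : w ⬝ᵥ (fun _ => e) = (∑ j, w j) * e := by rw [dotProduct, Finset.sum_mul]
      have h2 : (∑ j, w j + 1) * e = w ⬝ᵥ z - w ⬝ᵥ r := mul_div_cancel₀ _ (by linarith)
      rw [dotProduct_add, h1]
      linarith
  have hûS : û ∉ S := fun ⟨r, hr, hrz⟩ => absurd (hmin r hr) (not_le.2 hrz)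
  obtain ⟨f, hf⟩ := geometric_hahn_banach_open_point hSconv hSopen hûS
  have hww : 0 < w ⬝ᵥ w := lt_of_le_of_ne
    (Finset.sum_nonneg fun j _ => mul_self_nonneg (w j)) fun h => hw' (dotProduct_self_eq_zero.1 h.symm)
  set z₀ : Fin J → ℝ := (w ⬝ᵥ w)⁻¹ • w
  have hz₀ : w ⬝ᵥ z₀ = 1 := by
    rw [dotProduct_smul, smul_eq_mul, inv_mul_cancel₀ hww.ne']
  set m : Fin I → Fin J → ℝ := fun i j => f (Pi.single i (Pi.single j 1))
  have hfm : ∀ u, f u = ∑ i, ∑ j, m i j * u i j := by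
    intro u
    have hu : u = ∑ i, ∑ j, u i j • Pi.single i (Pi.single j (1 : ℝ)) := by
      funext i j
      simp only [Finset.sum_apply, Pi.smul_apply, smul_eq_mul]
      rw [Finset.sum_eq_single i, Finset.sum_eq_single j]
      · simp
      · intro k _ hk; simp [Pi.single_eq_of_ne hk.symm]
      · simp
      · intro k _ hk; simp [Pi.single_eq_of_ne hk.symm]
      · simp
    conv_lhs => rw [hu]
    simp only [map_sum, map_smul, smul_eq_mul, m, mul_comm]
  have hconst : ∀ r : Fin J → ℝ, 0 < w ⬝ᵥ r → 0 < f (fun _ => r) := by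
    intro r hr
    have := hf (û - fun _ => r) ⟨z + -r, hR.mem_add hz fun i j => by simp [sub_eq_add_neg], by
      rw [dotProduct_add, dotProduct_neg]; linarith⟩
    rw [map_sub] at this
    linarith
  set κ := f (fun _ => z₀)
  have hκ : 0 < κ := hconst z₀ (by rw [hz₀]; exact one_pos)
  -- Positivity on the open half-space `w ⬝ᵥ r > 0` passes to its boundary; applied to `r` and `-r`,
  -- it shows that `f` on constants is a multiple of `w`.
  have hker : ∀ r : Fin J → ℝ, w ⬝ᵥ r = 0 → 0 ≤ f (fun _ => r) := by
    intro r hr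
    refine le_of_forall_pos_le_add fun s hs => ?_
    have h1 := hconst (r + (s / κ) • z₀) (by
      rw [dotProduct_add, dotProduct_smul, hr, hz₀, zero_add, smul_eq_mul, mul_one]
      positivity)
    have h2 : f (fun _ => r + (s / κ) • z₀) = f (fun _ => r) + s / κ * κ := by
      rw [← smul_eq_mul, ← map_smul, ← map_add]; rfl
    rw [h2, div_mul_cancel₀ _ hκ.ne'] at h1
    exact h1.le
  have hfconst : ∀ r : Fin J → ℝ, f (fun _ => r) = κ * (w ⬝ᵥ r) := by
    intro r
    have h0 : w ⬝ᵥ (r - (w ⬝ᵥ r) • z₀) = 0 := by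
      rw [dotProduct_sub, dotProduct_smul, hz₀, smul_eq_mul, mul_one, sub_self]
    have h1 := hker _ h0
    have h2 := hker (-(r - (w ⬝ᵥ r) • z₀)) (by rw [dotProduct_neg, h0, neg_zero])
    have h3 : f (fun _ => r - (w ⬝ᵥ r) • z₀) = f (fun _ => r) - (w ⬝ᵥ r) * κ := by
      rw [← smul_eq_mul, ← map_smul, ← map_sub]; rfl
    have h4 : f (fun _ => -(r - (w ⬝ᵥ r) • z₀)) = -f (fun _ => r - (w ⬝ᵥ r) • z₀) := by
      rw [← map_neg]; rfl
    rw [h4, h3] at h2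
    rw [h3] at h1
    linarith
  have hmsum : ∀ j, ∑ i, m i j = κ * w j := by
    intro j
    have h1 := hfconst (Pi.single j 1)
    rw [dotProduct_single_one, hfm] at h1
    rw [← h1]
    refine Finset.sum_congr rfl fun i _ => ?_
    rw [Finset.sum_eq_single j (fun k _ hk => by simp [Pi.single_eq_of_ne hk]) (by simp)]
    simp
  have hmnn : ∀ i j, 0 ≤ m i j := by
    intro i j
    by_contra hneg
    push Not at hneg
    -- Shifting `û` by `-z₀` enters `S`, and lowering one coordinate stays there. With this `t`, a
    -- negative `m i j` would restore exactly the value `f û`, against strict separation.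
    set t := κ / (-m i j)
    have ht : 0 ≤ t := div_nonneg hκ.le (by linarith)
    have h1 := hf (û - (fun _ => z₀) - t • (Pi.single i (Pi.single j (1 : ℝ)) : Fin I → Fin J → ℝ)) ⟨z + -z₀,
      hR.mem_add hz fun i' j' => by
        have : 0 ≤ (Pi.single i (Pi.single j (1 : ℝ)) : Fin I → Fin J → ℝ) i' j' := by
          have h0 : (0 : Fin I → Fin J → ℝ) ≤ Pi.single i (Pi.single j (1 : ℝ)) :=
            Pi.single_nonneg.2 (Pi.single_nonneg.2 zero_le_one)
          exact h0 i' j'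
        have := mul_nonneg ht this
        simp only [Pi.sub_apply, Pi.smul_apply, smul_eq_mul, Pi.neg_apply]
        linarith, by
      rw [dotProduct_add, dotProduct_neg, hz₀]; linarith⟩
    rw [map_sub, map_sub, map_smul, smul_eq_mul] at h1
    change f û - κ - t * m i j < f û at h1
    have h2 : t * m i j = -κ := by
      rw [← neg_inj, ← mul_neg, neg_neg]
      exact div_mul_cancel₀ _ (by linarith)
    linarith
  have hm0 : ∀ i j, w j = 0 → m i j = 0 := by
    intro i j hj
    have h1 := hmsum j
    rw [hj, mul_zero] at h1
    exact (Finset.sum_eq_zero_iff_of_nonneg fun i _ => hmnn i j).1 h1 i (Finset.mem_univ i)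
  have hIpos : (0 : ℝ) < I := by
    have : 0 < I := Fin.pos_iff_nonempty.2 inferInstance
    exact_mod_cast this
  -- Where `w j = 0`, the column of `m` vanishes and any probability measure serves; the uniform one
  -- is taken.
  refine ⟨fun i j => if w j = 0 then (I : ℝ)⁻¹ else m i j / (κ * w j), ⟨fun i j => ?_, fun j => ?_⟩,
    ?_⟩
  · dsimp only
    split_ifs with hj
    · positivity
    · exact div_nonneg (hmnn i j) (mul_nonneg hκ.le (hw j))
  · dsimp only
    split_ifs with hj
    · rw [Finset.sum_const, Finset.card_univ, Fintype.card_fin, nsmul_eq_mul,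
        mul_inv_cancel₀ hIpos.ne']
    · rw [← Finset.sum_div, hmsum, div_self (mul_ne_zero hκ.ne' hj)]
  · set μ : Fin I → Fin J → ℝ := fun i j => if w j = 0 then (I : ℝ)⁻¹ else m i j / (κ * w j)
    have hμ : ∀ u, weightedExp w μ u = f u / κ := by
      intro u
      rw [weightedExp_eq_sum_sum, hfm, Finset.sum_div]
      refine Finset.sum_congr rfl fun i _ => ?_
      rw [Finset.sum_div]
      refine Finset.sum_congr rfl fun j _ => ?_
      simp only [μ]
      split_ifs with hj
      · rw [hj, hm0 i j hj]; simp
      · field_simp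
    intro u hu
    rw [hμ, hμ]
    refine le_of_forall_pos_le_add fun s hs => ?_
    -- An acceptable `u` has scalarized risk at most zero, so this shift puts it into `S` for every
    -- `s > 0`.
    have h1 := hf (u + fun _ => (w ⬝ᵥ z - s) • z₀) ⟨0 + (w ⬝ᵥ z - s) • z₀,
      hR.mem_add hu fun i j => le_rfl, by
        rw [zero_add, dotProduct_smul, hz₀, smul_eq_mul]; linarith⟩
    rw [map_add, hfconst, dotProduct_smul, hz₀, smul_eq_mul, mul_one] at h1
    have h2 : f u / κ + (w ⬝ᵥ z - s) ≤ f û / κ := by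
      rw [← mul_div_cancel_left₀ (w ⬝ᵥ z - s) hκ.ne', ← add_div]
      exact div_le_div_of_nonneg_right h1.le hκ.le
    linarith

/-! ### Squared distances and limiting inequalities. -/

/-- The squared Frobenius distance. -/
def sqDist {m n : ℕ} (a b : Fin m → Fin n → ℝ) : ℝ := ∑ i, ∑ j, (a i j - b i j) ^ 2

section SqDist

variable {m n : ℕ}

theorem sqDist_nonneg (a b : Fin m → Fin n → ℝ) : 0 ≤ sqDist a b := by
  unfold sqDist; positivity

theorem sqDist_comm (a b : Fin m → Fin n → ℝ) : sqDist a b = sqDist b a :=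
  Finset.sum_congr rfl fun i _ => Finset.sum_congr rfl fun j _ => by ring

theorem sq_sub_le_sqDist (a b : Fin m → Fin n → ℝ) (i : Fin m) (j : Fin n) :
    (a i j - b i j) ^ 2 ≤ sqDist a b :=
  (Finset.single_le_sum (f := fun j => (a i j - b i j) ^ 2) (fun _ _ => sq_nonneg _)
    (Finset.mem_univ j)).trans
    (Finset.single_le_sum (f := fun i => ∑ j, (a i j - b i j) ^ 2)
      (fun _ _ => Finset.sum_nonneg fun _ _ => sq_nonneg _) (Finset.mem_univ i))

theorem eq_of_sqDist_le_zero {a b : Fin m → Fin n → ℝ} (h : sqDist a b ≤ 0) : a = b := by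
  funext i j
  have := (sq_sub_le_sqDist a b i j).trans h
  exact sub_eq_zero.1 (pow_eq_zero_iff two_ne_zero |>.1 (le_antisymm this (sq_nonneg _)))

/-- The last term is the source of strong concavity of the master objective. -/
theorem sqDist_combination (a b c : Fin m → Fin n → ℝ) (s : ℝ) :
    sqDist ((1 - s) • a + s • b) c
      = (1 - s) * sqDist a c + s * sqDist b c - s * (1 - s) * sqDist a b := by
  simp only [sqDist, Finset.mul_sum, ← Finset.sum_add_distrib, ← Finset.sum_sub_distrib]
  refine Finset.sum_congr rfl fun i _ => Finset.sum_congr rfl fun j _ => ?_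
  simp only [Pi.add_apply, Pi.smul_apply, smul_eq_mul]
  ring

end SqDist

theorem le_of_forall_mul_le {a b e : ℝ} (h : ∀ s : ℝ, 0 < s → s ≤ 1 → a ≤ b + s * e) : a ≤ b := by
  refine le_of_forall_pos_le_add fun r hr => ?_
  have hpos : 0 < |e| + 1 := by positivity
  have h1 := h (min 1 (r / (|e| + 1))) (by positivity) (min_le_left _ _)
  have h2 : min 1 (r / (|e| + 1)) * e ≤ r := by
    calc min 1 (r / (|e| + 1)) * e ≤ min 1 (r / (|e| + 1)) * (|e| + 1) := by
          have := le_abs_self e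
          exact mul_le_mul_of_nonneg_left (by linarith) (by positivity)
      _ ≤ r / (|e| + 1) * (|e| + 1) :=
          mul_le_mul_of_nonneg_right (min_le_right _ _) hpos.le
      _ = r := div_mul_cancel₀ _ hpos.ne'
  linarith

theorem eq_zero_of_forall_add_mul_le {a c B : ℝ} (h : ∀ s : ℝ, c + a * s ≤ B) : a = 0 := by
  by_contra ha
  have := h ((B - c + 1) / a)
  rw [mul_div_cancel₀ _ ha] at this
  linarith

/-! ### Lagrangian duality for the master problem. -/

namespace Trace

variable {I J K L M N : ℕ} {t : Trace I J M N} {D : Data I J K L M N} {w : Fin J → ℝ}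
  {ϱ : ℝ} {k : ℕ} {S : Finset ℕ}

theorem masterObjective_eq (t : Trace I J M N) (ϱ : ℝ) (k : ℕ) (q : MasterVars I J M) :
    t.masterObjective ϱ k q = (∑ i, q.vartheta i) + q.eta
      - ϱ * (sqDist q.mu (t.cmu k) + sqDist q.lam (t.clam k)) := by
  simp only [masterObjective, sqDist, ← Finset.mul_sum]
  ring

theorem fCut_eq (t : Trace I J M N) (D : Data I J K L M N) (w : Fin J → ℝ) (ℓ : ℕ) (i : Fin I)
    (μi : Fin J → ℝ) (lami : Fin M → ℝ) :
    t.fCut D w ℓ i μi lami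
      = t.fCut D w ℓ i 0 0 + t.gmu D w ℓ i ⬝ᵥ μi + t.glam D ℓ i ⬝ᵥ lami := by
  simp only [fCut, dotProduct_sub, dotProduct_zero]
  ring

theorem bCut_eq (t : Trace I J M N) (ℓ : ℕ) (μ : Fin I → Fin J → ℝ) :
    t.bCut ℓ μ = t.bCut ℓ 0 + ∑ i, t.rho ℓ i ⬝ᵥ μ i := by
  simp only [bCut, dotProduct_sub, Finset.sum_sub_distrib, Pi.zero_apply, dotProduct_zero,
    Finset.sum_const_zero]
  ring

theorem fCut_combination (ℓ : ℕ) (i : Fin I) (μi μi' : Fin J → ℝ) (lami lami' : Fin M → ℝ)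
    (s : ℝ) :
    t.fCut D w ℓ i ((1 - s) • μi + s • μi') ((1 - s) • lami + s • lami')
      = (1 - s) * t.fCut D w ℓ i μi lami + s * t.fCut D w ℓ i μi' lami' := by
  rw [fCut_eq t D w ℓ i μi, fCut_eq t D w ℓ i μi', fCut_eq]
  simp only [dotProduct_add, dotProduct_smul, smul_eq_mul]
  ring

theorem bCut_combination (ℓ : ℕ) (μ μ' : Fin I → Fin J → ℝ) (s : ℝ) :
    t.bCut ℓ ((1 - s) • μ + s • μ') = (1 - s) * t.bCut ℓ μ + s * t.bCut ℓ μ' := by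
  rw [bCut_eq t ℓ μ, bCut_eq t ℓ μ', bCut_eq]
  simp only [Pi.add_apply, Pi.smul_apply, dotProduct_add, dotProduct_smul, smul_eq_mul,
    Finset.sum_add_distrib, ← Finset.mul_sum]
  ring

/-- Strong concavity of the master problem. -/
theorem IsMasterOptimal.add_sqDist_le {q q' : MasterVars I J M}
    (h : t.IsMasterOptimal D w ϱ k S q) (h' : t.MasterFeasible D w S q') :
    t.masterObjective ϱ k q' + ϱ * (sqDist q'.mu q.mu + sqDist q'.lam q.lam)
      ≤ t.masterObjective ϱ k q := by
  -- Compare `q` with the feasible point at fraction `s` towards `q'`; dividing by `s` leaves an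
  -- error `s * e`, which vanishes in the limit.
  refine le_of_forall_mul_le (e := ϱ * (sqDist q'.mu q.mu + sqDist q'.lam q.lam))
    fun s hs hs1 => ?_
  have hs1' : 0 ≤ 1 - s := by linarith
  let r : MasterVars I J M := ⟨(1 - s) • q.mu + s • q'.mu, (1 - s) • q.lam + s • q'.lam,
    (1 - s) • q.vartheta + s • q'.vartheta, (1 - s) * q.eta + s * q'.eta⟩
  have hr : t.MasterFeasible D w S r := by
    refine ⟨fun i ℓ hℓ => ?_, fun ℓ hℓ => ?_, ?_, ?_, fun i j => ?_⟩
    · change (1 - s) * q.vartheta i + s * q'.vartheta i ≤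
        t.fCut D w ℓ i ((1 - s) • q.mu i + s • q'.mu i) ((1 - s) • q.lam i + s • q'.lam i)
      rw [fCut_combination]
      exact add_le_add (mul_le_mul_of_nonneg_left (h.1.cut_f i ℓ hℓ) hs1')
        (mul_le_mul_of_nonneg_left (h'.cut_f i ℓ hℓ) hs.le)
    · change (1 - s) * q.eta + s * q'.eta ≤ t.bCut ℓ ((1 - s) • q.mu + s • q'.mu)
      rw [bCut_combination]
      exact add_le_add (mul_le_mul_of_nonneg_left (h.1.cut_b ℓ hℓ) hs1')
        (mul_le_mul_of_nonneg_left (h'.cut_b ℓ hℓ) hs.le)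
    · have : ∑ i, D.p i • r.lam i
          = (1 - s) • ∑ i, D.p i • q.lam i + s • ∑ i, D.p i • q'.lam i := by
        simp only [Finset.smul_sum, ← Finset.sum_add_distrib]
        refine Finset.sum_congr rfl fun i _ => ?_
        simp only [r, Pi.add_apply, Pi.smul_apply]
        module
      rw [this, h.1.mean_zero, h'.mean_zero, smul_zero, smul_zero, add_zero]
    · have : ∑ i, r.mu i = (1 - s) • ∑ i, q.mu i + s • ∑ i, q'.mu i := by
        simp only [Finset.smul_sum, ← Finset.sum_add_distrib]
        rfl
      rw [this, h.1.mu_sum, h'.mu_sum, ← add_smul, sub_add_cancel, one_smul]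
    · exact add_nonneg (mul_nonneg hs1' (h.1.mu_nonneg i j)) (mul_nonneg hs.le (h'.mu_nonneg i j))
  have h1 := h.2 r hr
  have h2 : ∑ i, r.vartheta i = (1 - s) * ∑ i, q.vartheta i + s * ∑ i, q'.vartheta i := by
    simp only [Finset.mul_sum, ← Finset.sum_add_distrib]
    rfl
  rw [masterObjective_eq] at h1
  simp only [h2] at h1
  simp only [r, sqDist_combination] at h1
  rw [sqDist_comm q'.mu, sqDist_comm q'.lam]
  rw [masterObjective_eq] at h1 ⊢
  rw [masterObjective_eq]
  nlinarith [h1]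

/-- Gradient of the Lagrangian with respect to `μ`, without the proximal term. -/
def gradMu (t : Trace I J M N) (D : Data I J K L M N) (w : Fin J → ℝ) (S : Finset ℕ)
    (d : DualVars I J M) : Fin I → Fin J → ℝ := fun i =>
  ∑ ℓ ∈ S, d.τ i ℓ • t.gmu D w ℓ i + ∑ ℓ ∈ S, d.θ ℓ • t.rho ℓ i - d.Ψ + d.ν i

/-- Gradient of the Lagrangian with respect to `λ`, without the proximal term. -/
def gradLam (t : Trace I J M N) (D : Data I J K L M N) (S : Finset ℕ)
    (d : DualVars I J M) : Fin I → Fin M → ℝ := fun i =>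
  ∑ ℓ ∈ S, d.τ i ℓ • t.glam D ℓ i - D.p i • d.σ

/-- Collecting terms shows that `vartheta` and `eta` enter only linearly, with coefficients that
vanish exactly for normalized multipliers, while `mu` and `lam` enter through concave quadratics
with explicit maximizers. -/
theorem lagrangian_eq (t : Trace I J M N) (D : Data I J K L M N) (w : Fin J → ℝ) (ϱ : ℝ) (k : ℕ)
    (S : Finset ℕ) (q : MasterVars I J M) (d : DualVars I J M) :
    t.lagrangian D w ϱ k S q d =
      (∑ i, ∑ ℓ ∈ S, d.τ i ℓ * t.fCut D w ℓ i 0 0 + ∑ ℓ ∈ S, d.θ ℓ * t.bCut ℓ 0 + d.Ψ ⬝ᵥ 1)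
      + ∑ i, t.gradMu D w S d i ⬝ᵥ q.mu i + ∑ i, t.gradLam D S d i ⬝ᵥ q.lam i
      - ϱ * (sqDist q.mu (t.cmu k) + sqDist q.lam (t.clam k))
      + ∑ i, (1 - ∑ ℓ ∈ S, d.τ i ℓ) * q.vartheta i + (1 - ∑ ℓ ∈ S, d.θ ℓ) * q.eta := by
  have h1 : ∀ i, ∑ ℓ ∈ S, d.τ i ℓ * (t.fCut D w ℓ i (q.mu i) (q.lam i) - q.vartheta i)
      = ∑ ℓ ∈ S, d.τ i ℓ * t.fCut D w ℓ i 0 0 + (∑ ℓ ∈ S, d.τ i ℓ • t.gmu D w ℓ i) ⬝ᵥ q.mu i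
        + (∑ ℓ ∈ S, d.τ i ℓ • t.glam D ℓ i) ⬝ᵥ q.lam i - (∑ ℓ ∈ S, d.τ i ℓ) * q.vartheta i := by
    intro i
    simp only [sum_dotProduct, smul_dotProduct, smul_eq_mul, Finset.sum_mul,
      ← Finset.sum_add_distrib, ← Finset.sum_sub_distrib]
    refine Finset.sum_congr rfl fun ℓ _ => ?_
    rw [fCut_eq]
    ring
  have h2 : ∑ ℓ ∈ S, d.θ ℓ * (t.bCut ℓ q.mu - q.eta)
      = ∑ ℓ ∈ S, d.θ ℓ * t.bCut ℓ 0 + ∑ i, (∑ ℓ ∈ S, d.θ ℓ • t.rho ℓ i) ⬝ᵥ q.mu i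
        - (∑ ℓ ∈ S, d.θ ℓ) * q.eta := by
    simp only [sum_dotProduct, smul_dotProduct, smul_eq_mul]
    rw [Finset.sum_comm]
    simp only [← Finset.mul_sum, Finset.sum_mul, ← Finset.sum_add_distrib,
      ← Finset.sum_sub_distrib]
    refine Finset.sum_congr rfl fun ℓ _ => ?_
    rw [bCut_eq]
    ring
  have h3 : ∑ i, t.gradMu D w S d i ⬝ᵥ q.mu i
      = ∑ i, (∑ ℓ ∈ S, d.τ i ℓ • t.gmu D w ℓ i) ⬝ᵥ q.mu i
        + ∑ i, (∑ ℓ ∈ S, d.θ ℓ • t.rho ℓ i) ⬝ᵥ q.mu i - d.Ψ ⬝ᵥ ∑ i, q.mu i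
        + ∑ i, d.ν i ⬝ᵥ q.mu i := by
    simp only [gradMu, add_dotProduct, sub_dotProduct, Finset.sum_add_distrib,
      Finset.sum_sub_distrib, dotProduct_sum]
  have h4 : ∑ i, t.gradLam D S d i ⬝ᵥ q.lam i
      = ∑ i, (∑ ℓ ∈ S, d.τ i ℓ • t.glam D ℓ i) ⬝ᵥ q.lam i
        - d.σ ⬝ᵥ ∑ i, D.p i • q.lam i := by
    simp only [gradLam, sub_dotProduct, Finset.sum_sub_distrib, dotProduct_sum, smul_dotProduct,
      dotProduct_smul]
  rw [lagrangian, masterObjective_eq, Finset.sum_congr rfl fun i _ => h1 i, h2, h3, h4]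
  simp only [Finset.sum_add_distrib, Finset.sum_sub_distrib, sub_mul, one_mul, dotProduct_sub]
  ring

/-- The multipliers of the cuts form convex combinations. -/
def _root_.TwoStage.DualVars.Normalized (S : Finset ℕ) (d : DualVars I J M) : Prop :=
  (∀ i, ∑ ℓ ∈ S, d.τ i ℓ = 1) ∧ ∑ ℓ ∈ S, d.θ ℓ = 1

/-- The `μ`-part of the maximizer of the Lagrangian. -/
def maxMu (t : Trace I J M N) (D : Data I J K L M N) (w : Fin J → ℝ) (ϱ : ℝ) (k : ℕ)
    (S : Finset ℕ) (d : DualVars I J M) : Fin I → Fin J → ℝ :=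
  t.cmu k + (2 * ϱ)⁻¹ • t.gradMu D w S d

/-- The `λ`-part of the maximizer of the Lagrangian. -/
def maxLam (t : Trace I J M N) (D : Data I J K L M N) (ϱ : ℝ) (k : ℕ)
    (S : Finset ℕ) (d : DualVars I J M) : Fin I → Fin M → ℝ :=
  t.clam k + (2 * ϱ)⁻¹ • t.gradLam D S d

/-- Completing the square. -/
theorem sum_dotProduct_sub_sqDist {m n : ℕ} (hϱ : 0 < ϱ) (g c x : Fin m → Fin n → ℝ) :
    ∑ i, g i ⬝ᵥ x i - ϱ * sqDist x c
      = ∑ i, g i ⬝ᵥ (c + (2 * ϱ)⁻¹ • g) i - ϱ * sqDist (c + (2 * ϱ)⁻¹ • g) c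
        - ϱ * sqDist x (c + (2 * ϱ)⁻¹ • g) := by
  simp only [sqDist, dotProduct, Finset.mul_sum, ← Finset.sum_sub_distrib]
  refine Finset.sum_congr rfl fun i _ => Finset.sum_congr rfl fun j _ => ?_
  simp only [Pi.add_apply, Pi.smul_apply, smul_eq_mul]
  field_simp
  ring

theorem lagrangian_eq_sub (hϱ : 0 < ϱ) {d : DualVars I J M} (hd : d.Normalized S)
    (q q₀ : MasterVars I J M) (hmu : q₀.mu = t.maxMu D w ϱ k S d)
    (hlam : q₀.lam = t.maxLam D ϱ k S d) :
    t.lagrangian D w ϱ k S q d = t.lagrangian D w ϱ k S q₀ d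
      - ϱ * (sqDist q.mu q₀.mu + sqDist q.lam q₀.lam) := by
  have h1 := sum_dotProduct_sub_sqDist hϱ (t.gradMu D w S d) (t.cmu k) q.mu
  have h2 := sum_dotProduct_sub_sqDist hϱ (t.gradLam D S d) (t.clam k) q.lam
  rw [lagrangian_eq, lagrangian_eq]
  simp only [hd.1, hd.2, sub_self, zero_mul, Finset.sum_const_zero, hmu, hlam, maxMu, maxLam]
  linarith

/-- Convex combination of two multiplier vectors. -/
def _root_.TwoStage.DualVars.combination (s : ℝ) (d d' : DualVars I J M) : DualVars I J M where
  τ := fun i ℓ => (1 - s) * d.τ i ℓ + s * d'.τ i ℓ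
  θ := fun ℓ => (1 - s) * d.θ ℓ + s * d'.θ ℓ
  σ := (1 - s) • d.σ + s • d'.σ
  Ψ := (1 - s) • d.Ψ + s • d'.Ψ
  ν := fun i => (1 - s) • d.ν i + s • d'.ν i

theorem lagrangian_combination (q : MasterVars I J M) (s : ℝ) (d d' : DualVars I J M) :
    t.lagrangian D w ϱ k S q (DualVars.combination s d d')
      = (1 - s) * t.lagrangian D w ϱ k S q d + s * t.lagrangian D w ϱ k S q d' := by
  simp only [lagrangian, DualVars.combination, add_mul, mul_assoc, Finset.sum_add_distrib,
    ← Finset.mul_sum, add_dotProduct, smul_dotProduct, smul_eq_mul]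
  ring

theorem gradMu_combination (s : ℝ) (d d' : DualVars I J M) :
    t.gradMu D w S (DualVars.combination s d d')
      = (1 - s) • t.gradMu D w S d + s • t.gradMu D w S d' := by
  funext i
  simp only [gradMu, DualVars.combination, add_smul, mul_smul, Finset.sum_add_distrib,
    ← Finset.smul_sum, Pi.add_apply, Pi.smul_apply]
  module

theorem gradLam_combination (s : ℝ) (d d' : DualVars I J M) :
    t.gradLam D S (DualVars.combination s d d')
      = (1 - s) • t.gradLam D S d + s • t.gradLam D S d' := by
  funext i
  simp only [gradLam, DualVars.combination, add_smul, mul_smul, Finset.sum_add_distrib,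
    ← Finset.smul_sum, Pi.add_apply, Pi.smul_apply]
  module

theorem dualFunction_eq (hϱ : 0 < ϱ) {d : DualVars I J M} (hd : d.Normalized S)
    (q₀ : MasterVars I J M) (hmu : q₀.mu = t.maxMu D w ϱ k S d)
    (hlam : q₀.lam = t.maxLam D ϱ k S d) :
    t.dualFunction D w ϱ k S d = ((t.lagrangian D w ϱ k S q₀ d : ℝ) : EReal) := by
  refine le_antisymm (iSup_le fun q => EReal.coe_le_coe_iff.2 ?_)
    (le_iSup (fun q => ((t.lagrangian D w ϱ k S q d : ℝ) : EReal)) q₀)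
  rw [lagrangian_eq_sub hϱ hd q q₀ hmu hlam]
  have := mul_nonneg hϱ.le (add_nonneg (sqDist_nonneg q.mu q₀.mu) (sqDist_nonneg q.lam q₀.lam))
  linarith

/-- An affine function of `vartheta i` or of `eta` that is bounded above is constant. -/
theorem normalized_of_dualFunction_le {d : DualVars I J M} {B : ℝ}
    (h : t.dualFunction D w ϱ k S d ≤ (B : EReal)) : d.Normalized S := by
  have hL : ∀ q, t.lagrangian D w ϱ k S q d ≤ B := fun q =>
    EReal.coe_le_coe_iff.1
      ((le_iSup (fun q => ((t.lagrangian D w ϱ k S q d : ℝ) : EReal)) q).trans h)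
  simp only [lagrangian_eq] at hL
  let C := (∑ i, ∑ ℓ ∈ S, d.τ i ℓ * t.fCut D w ℓ i 0 0 + ∑ ℓ ∈ S, d.θ ℓ * t.bCut ℓ 0 + d.Ψ ⬝ᵥ 1)
    - ϱ * (sqDist 0 (t.cmu k) + sqDist 0 (t.clam k))
  refine ⟨fun i => ?_, ?_⟩
  · refine (sub_eq_zero.1 (eq_zero_of_forall_add_mul_le (B := B) (c := C)
      fun s => ?_)).symm
    have := hL ⟨0, 0, Pi.single i s, 0⟩
    rw [Finset.sum_eq_single (f := fun i' => (1 - ∑ ℓ ∈ S, d.τ i' ℓ) *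
      (Pi.single i s : Fin I → ℝ) i') i (fun i' _ hi' => by simp [Pi.single_eq_of_ne hi'])
      (by simp)] at this
    simpa using this
  · refine (sub_eq_zero.1 (eq_zero_of_forall_add_mul_le (B := B) (c := C)
      fun s => ?_)).symm
    have := hL ⟨0, 0, 0, s⟩
    simpa using this

/-- The multipliers that select one cut for each `f_i` and one for `-β`. -/
def _root_.TwoStage.DualVars.select (ℓf : Fin I → ℕ) (ℓb : ℕ) : DualVars I J M where
  τ := fun i ℓ => if ℓ = ℓf i then 1 else 0
  θ := fun ℓ => if ℓ = ℓb then 1 else 0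
  σ := 0
  Ψ := 0
  ν := 0

theorem _root_.TwoStage.DualVars.select_feasible (ℓf : Fin I → ℕ) (ℓb : ℕ) :
    (DualVars.select ℓf ℓb : DualVars I J M).Feasible S := by
  refine ⟨fun i ℓ _ => ?_, fun ℓ _ => ?_, fun i j => le_rfl⟩
  · dsimp only [DualVars.select]; split_ifs <;> norm_num
  · dsimp only [DualVars.select]; split_ifs <;> norm_num

theorem _root_.TwoStage.DualVars.select_normalized {ℓf : Fin I → ℕ} {ℓb : ℕ}
    (hf : ∀ i, ℓf i ∈ S) (hb : ℓb ∈ S) :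
    (DualVars.select ℓf ℓb : DualVars I J M).Normalized S := by
  refine ⟨fun i => ?_, ?_⟩
  · simp [DualVars.select, hf i]
  · simp [DualVars.select, hb]

/-- The selected cuts are tight at `q`, so every multiplier term vanishes. -/
theorem lagrangian_select (q : MasterVars I J M) {ℓf : Fin I → ℕ} {ℓb : ℕ}
    (hf : ∀ i, ℓf i ∈ S) (hb : ℓb ∈ S)
    (hqf : ∀ i, q.vartheta i = t.fCut D w (ℓf i) i (q.mu i) (q.lam i))
    (hqb : q.eta = t.bCut ℓb q.mu) :
    t.lagrangian D w ϱ k S q (DualVars.select ℓf ℓb) = t.masterObjective ϱ k q := by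
  simp [lagrangian, DualVars.select, hf, hb, hqf, hqb]

/-- Selecting a single cut gives a finite dual value, so the optimal dual value is not `+∞`. -/
theorem IsDualOptimal.normalized (hϱ : 0 < ϱ) (hS : S.Nonempty) {d : DualVars I J M}
    (hd : t.IsDualOptimal D w ϱ k S d) : d.Normalized S := by
  obtain ⟨ℓ, hℓ⟩ := hS
  have h1 := hd.2 (DualVars.select (fun _ => ℓ) ℓ) (DualVars.select_feasible _ _)
  rw [dualFunction_eq hϱ (DualVars.select_normalized (fun _ => hℓ) hℓ)
    ⟨t.maxMu D w ϱ k S _, t.maxLam D ϱ k S _, 0, 0⟩ rfl rfl] at h1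
  exact normalized_of_dualFunction_le h1

/-- The saddle point property of dual optimal multipliers. -/
theorem IsDualOptimal.lagrangian_le (hϱ : 0 < ϱ) (hS : S.Nonempty) {d d' : DualVars I J M}
    (hd : t.IsDualOptimal D w ϱ k S d) (hd' : d'.Feasible S) (hn' : d'.Normalized S)
    (q₀ : MasterVars I J M) (hmu : q₀.mu = t.maxMu D w ϱ k S d)
    (hlam : q₀.lam = t.maxLam D ϱ k S d) :
    t.lagrangian D w ϱ k S q₀ d ≤ t.lagrangian D w ϱ k S q₀ d' := by
  have hn := hd.normalized hϱ hS
  -- An envelope argument. The Lagrangian maximizer depends affinely on the multipliers, so at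
  -- fraction `s` from `d` to `d'` it is at fraction `s` from `q₀` to `q₁`. Dual optimality of `d`,
  -- divided by `s`, gives the claim up to a term of order `s`.
  let q₁ : MasterVars I J M := ⟨t.maxMu D w ϱ k S d', t.maxLam D ϱ k S d', 0, 0⟩
  set Δ := ϱ * (sqDist q₀.mu q₁.mu + sqDist q₀.lam q₁.lam)
  have hΔ : 0 ≤ Δ := mul_nonneg hϱ.le (add_nonneg (sqDist_nonneg _ _) (sqDist_nonneg _ _))
  refine le_of_forall_mul_le (e := 2 * Δ) fun s hs hs1 => ?_
  have hs1' : 0 ≤ 1 - s := by linarith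
  set e := DualVars.combination s d d'
  have he : e.Feasible S :=
    ⟨fun i ℓ hℓ => add_nonneg (mul_nonneg hs1' (hd.1.τ_nonneg i ℓ hℓ))
        (mul_nonneg hs.le (hd'.τ_nonneg i ℓ hℓ)),
      fun ℓ hℓ => add_nonneg (mul_nonneg hs1' (hd.1.θ_nonneg ℓ hℓ))
        (mul_nonneg hs.le (hd'.θ_nonneg ℓ hℓ)),
      fun i j => add_nonneg (mul_nonneg hs1' (hd.1.ν_nonneg i j))
        (mul_nonneg hs.le (hd'.ν_nonneg i j))⟩
  have hne : e.Normalized S := by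
    refine ⟨fun i => ?_, ?_⟩
    · simp only [e, DualVars.combination, Finset.sum_add_distrib, ← Finset.mul_sum, hn.1, hn'.1]
      ring
    · simp only [e, DualVars.combination, Finset.sum_add_distrib, ← Finset.mul_sum, hn.2, hn'.2]
      ring
  let r : MasterVars I J M := ⟨t.maxMu D w ϱ k S e, t.maxLam D ϱ k S e, 0, 0⟩
  have hrmu : r.mu = (1 - s) • q₀.mu + s • q₁.mu := by
    simp only [r, q₁, hmu, maxMu, e, gradMu_combination]
    module
  have hrlam : r.lam = (1 - s) • q₀.lam + s • q₁.lam := by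
    simp only [r, q₁, hlam, maxLam, e, gradLam_combination]
    module
  have h1 := hd.2 e he
  rw [dualFunction_eq hϱ hn q₀ hmu hlam, dualFunction_eq hϱ hne r rfl rfl,
    EReal.coe_le_coe_iff, lagrangian_combination, lagrangian_eq_sub hϱ hn r q₀ hmu hlam] at h1
  have h2 : t.lagrangian D w ϱ k S q₀ d ≤ t.lagrangian D w ϱ k S r d' := by
    have h3 : 0 ≤ ϱ * (sqDist r.mu q₀.mu + sqDist r.lam q₀.lam) :=
      mul_nonneg hϱ.le (add_nonneg (sqDist_nonneg _ _) (sqDist_nonneg _ _))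
    have h4 : s * t.lagrangian D w ϱ k S q₀ d ≤ s * t.lagrangian D w ϱ k S r d' := by
      nlinarith [mul_nonneg hs1' h3]
    exact le_of_mul_le_mul_left h4 hs
  have h5 : t.lagrangian D w ϱ k S r d' = t.lagrangian D w ϱ k S q₀ d' + (2 * s - s ^ 2) * Δ := by
    rw [lagrangian_eq_sub hϱ hn' r q₁ rfl rfl, lagrangian_eq_sub hϱ hn' q₀ q₁ rfl rfl, hrmu, hrlam,
      sqDist_combination, sqDist_combination]
    have h0 : ∀ {m n : ℕ} (a : Fin m → Fin n → ℝ), sqDist a a = 0 := fun a => by simp [sqDist]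
    rw [h0, h0]
    simp only [Δ]
    ring
  nlinarith [mul_nonneg (sq_nonneg s) hΔ]

theorem MasterFeasible.le_lagrangian {q : MasterVars I J M} {d : DualVars I J M}
    (hq : t.MasterFeasible D w S q) (hd : d.Feasible S) :
    t.masterObjective ϱ k q ≤ t.lagrangian D w ϱ k S q d := by
  have h1 : 0 ≤ ∑ i, ∑ ℓ ∈ S, d.τ i ℓ * (t.fCut D w ℓ i (q.mu i) (q.lam i) - q.vartheta i) :=
    Finset.sum_nonneg fun i _ => Finset.sum_nonneg fun ℓ hℓ =>
      mul_nonneg (hd.τ_nonneg i ℓ hℓ) (sub_nonneg.2 (hq.cut_f i ℓ hℓ))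
  have h2 : 0 ≤ ∑ ℓ ∈ S, d.θ ℓ * (t.bCut ℓ q.mu - q.eta) :=
    Finset.sum_nonneg fun ℓ hℓ => mul_nonneg (hd.θ_nonneg ℓ hℓ) (sub_nonneg.2 (hq.cut_b ℓ hℓ))
  have h3 : 0 ≤ ∑ i, d.ν i ⬝ᵥ q.mu i :=
    Finset.sum_nonneg fun i _ => Finset.sum_nonneg fun j _ =>
      mul_nonneg (hd.ν_nonneg i j) (hq.mu_nonneg i j)
  rw [lagrangian, hq.mean_zero, hq.mu_sum, sub_self, dotProduct_zero, dotProduct_zero]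
  linarith

/-- Optimality conditions of the master problem: dual optimal multipliers represent the primal
optimal solution as the maximizer of the Lagrangian, without duality gap. -/
theorem IsDualOptimal.eq_of_isMasterOptimal (hϱ : 0 < ϱ) (hS : S.Nonempty) {d : DualVars I J M}
    (hd : t.IsDualOptimal D w ϱ k S d) {q : MasterVars I J M}
    (hq : t.IsMasterOptimal D w ϱ k S q) :
    q.lam = t.maxLam D ϱ k S d ∧
      ∀ q', t.lagrangian D w ϱ k S q' d
        = t.masterObjective ϱ k q - ϱ * (sqDist q'.mu q.mu + sqDist q'.lam q.lam) := by
  have hn := hd.normalized hϱ hS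
  set μ := t.maxMu D w ϱ k S d with hμ
  set lam := t.maxLam D ϱ k S d with hlam
  choose ℓf hℓf hℓf' using fun i =>
    S.exists_min_image (fun ℓ => t.fCut D w ℓ i (μ i) (lam i)) hS
  obtain ⟨ℓb, hℓb, hℓb'⟩ := S.exists_min_image (fun ℓ => t.bCut ℓ μ) hS
  -- The Lagrangian maximizer with `vartheta` and `eta` at the lowest cut. Feasibility follows by
  -- testing the saddle inequality with perturbed multipliers: moving `σ` or `Ψ` by the residual
  -- produces minus its squared norm.
  let q₀ : MasterVars I J M :=
    ⟨μ, lam, fun i => t.fCut D w (ℓf i) i (μ i) (lam i), t.bCut ℓb μ⟩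
  have hsaddle := fun (d' : DualVars I J M) (h : d'.Feasible S) (h' : d'.Normalized S) =>
    hd.lagrangian_le hϱ hS h h' q₀ rfl rfl
  have hmean : ∑ i, D.p i • lam i = 0 := by
    have h1 := hsaddle { d with σ := d.σ + ∑ i, D.p i • lam i }
      ⟨hd.1.τ_nonneg, hd.1.θ_nonneg, hd.1.ν_nonneg⟩ hn
    simp only [lagrangian, add_dotProduct] at h1
    have h2 : 0 ≤ (∑ i, D.p i • lam i) ⬝ᵥ ∑ i, D.p i • lam i :=
      Finset.sum_nonneg fun m _ => mul_self_nonneg _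
    refine dotProduct_self_eq_zero.1 (le_antisymm ?_ h2)
    linarith
  have hsum : ∑ i, μ i = 1 := by
    have h1 := hsaddle { d with Ψ := d.Ψ - (1 - ∑ i, μ i) }
      ⟨hd.1.τ_nonneg, hd.1.θ_nonneg, hd.1.ν_nonneg⟩ hn
    simp only [lagrangian, sub_dotProduct d.Ψ] at h1
    have h2 : 0 ≤ (1 - ∑ i, μ i) ⬝ᵥ (1 - ∑ i, μ i) :=
      Finset.sum_nonneg fun m _ => mul_self_nonneg _
    refine (sub_eq_zero.1 (dotProduct_self_eq_zero.1 (le_antisymm ?_ h2))).symm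
    linarith
  have hnn : ∀ i j, 0 ≤ μ i j := by
    intro i j
    have h1 := hsaddle { d with ν := d.ν + Pi.single i (Pi.single j (1 : ℝ)) }
      ⟨hd.1.τ_nonneg, hd.1.θ_nonneg, fun i' j' => add_nonneg (hd.1.ν_nonneg i' j') (by
        have h0 : (0 : Fin I → Fin J → ℝ) ≤ Pi.single i (Pi.single j (1 : ℝ)) :=
          Pi.single_nonneg.2 (Pi.single_nonneg.2 zero_le_one)
        exact h0 i' j')⟩ hn
    simp only [lagrangian, Pi.add_apply, add_dotProduct, Finset.sum_add_distrib] at h1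
    have h2 : ∑ i', (Pi.single i (Pi.single j (1 : ℝ)) : Fin I → Fin J → ℝ) i' ⬝ᵥ q₀.mu i'
        = μ i j := by
      rw [Finset.sum_eq_single i (fun i' _ hi' => by simp [Pi.single_eq_of_ne hi']) (by simp)]
      simp [q₀]
    rw [h2] at h1
    linarith
  have hq₀ : t.MasterFeasible D w S q₀ :=
    ⟨fun i ℓ hℓ => hℓf' i ℓ hℓ, fun ℓ hℓ => hℓb' ℓ hℓ, hmean, hsum, hnn⟩
  -- Testing with the multipliers that select the tight cuts closes the duality gap at `q₀`; the
  -- quadratic loss at `q` then forces `q` and `q₀` to share `mu` and `lam`.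
  have h1 : t.lagrangian D w ϱ k S q₀ d ≤ t.masterObjective ϱ k q₀ := by
    rw [← lagrangian_select (D := D) (w := w) q₀ hℓf hℓb (fun _ => rfl) rfl]
    exact hsaddle _ (DualVars.select_feasible _ _) (DualVars.select_normalized hℓf hℓb)
  have h2 := hq.2 q₀ hq₀
  have h3 := hq.1.le_lagrangian (ϱ := ϱ) (k := k) hd.1
  rw [lagrangian_eq_sub hϱ hn q q₀ rfl rfl] at h3
  have h4 := sqDist_nonneg q.mu q₀.mu
  have h5 := sqDist_nonneg q.lam q₀.lam
  have h6 : ϱ * (sqDist q.mu q₀.mu + sqDist q.lam q₀.lam) ≤ 0 := by linarith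
  have h7 : sqDist q.mu q₀.mu + sqDist q.lam q₀.lam ≤ 0 :=
    nonpos_of_mul_nonpos_right h6 hϱ
  have hmu' : q.mu = q₀.mu := eq_of_sqDist_le_zero (by linarith)
  have hlam' : q.lam = q₀.lam := eq_of_sqDist_le_zero (by linarith)
  refine ⟨hlam', fun q' => ?_⟩
  rw [lagrangian_eq_sub hϱ hn q' q₀ rfl rfl, hmu', hlam']
  have h8 : 0 ≤ ϱ * (sqDist q.mu q₀.mu + sqDist q.lam q₀.lam) :=
    mul_nonneg hϱ.le (add_nonneg h4 h5)
  linarith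

end Trace

/-! ### Cuts and centers along a run. -/

namespace Trace

variable {I J K L M N : ℕ} {t : Trace I J M N} {D : Data I J K L M N} {w : Fin J → ℝ}
  {R : (Fin I → Fin J → ℝ) → Set (Fin J → ℝ)} {ϱ γ ε : ℝ} {k m n : ℕ}
  {μ₁ : Fin I → Fin J → ℝ} {lam₁ : Fin I → Fin M → ℝ}

namespace IsEvaluation

theorem isDualBound (h : t.IsEvaluation D w R γ k) (hμ : t.mu k ∈ probVectors I J)
    (hlam : MeanZero D (t.lam k)) :
    IsDualBound D R w (t.mu k) (t.lam k) (t.fval k) (t.bval k) := by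
  refine ⟨hμ, hlam, fun i v hv => ?_, fun u hu => ?_⟩
  · rw [← EReal.coe_le_coe_iff, h.fval_eq i]
    exact iInf₂_le v hv
  · rw [← EReal.coe_le_coe_iff, h.bval_eq]
    exact le_iSup₂ (f := fun u (_ : u ∈ {u : Fin I → Fin J → ℝ | 0 ∈ R u}) =>
      ((weightedExp w (t.mu k) u : ℝ) : EReal)) u hu

theorem fval_eq_subObjective (h : t.IsEvaluation D w R γ k) (i : Fin I) :
    t.fval k i = subObjective D w i (t.mu k i) (t.lam k i) (t.x k i, t.y k i) := by
  rw [← EReal.coe_eq_coe_iff, h.fval_eq i]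
  exact le_antisymm (iInf₂_le _ (h.sub_feasible i))
    (le_iInf₂ fun v hv => EReal.coe_le_coe_iff.2 (h.sub_optimal i v hv))

/-- The cuts for `f_i` are the objectives of the subproblem solutions. -/
theorem fCut_eq_subObjective (h : t.IsEvaluation D w R γ k) (i : Fin I) (μi : Fin J → ℝ)
    (lami : Fin M → ℝ) :
    t.fCut D w k i μi lami = subObjective D w i μi lami (t.x k i, t.y k i) := by
  have h1 : ∀ ν c : Fin J → ℝ, (w * c) ⬝ᵥ ν = w ⬝ᵥ (ν * c) := fun ν c =>
    Finset.sum_congr rfl fun j _ => by simp only [Pi.mul_apply]; ring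
  rw [fCut, h.fval_eq_subObjective i, gmu, glam, subObjective, subObjective, dotProduct_sub,
    dotProduct_sub, h1, h1, smul_dotProduct, smul_dotProduct, smul_eq_mul, smul_eq_mul,
    dotProduct_comm (t.x k i) lami, dotProduct_comm (t.x k i) (t.lam k i)]
  ring

theorem neg_le_bCut (h : t.IsEvaluation D w R γ k) {μ : Fin I → Fin J → ℝ}
    (hμ : μ ∈ probVectors I J) {b : ℝ} (hb : ∀ u, 0 ∈ R u → weightedExp w μ u ≤ b) :
    -b ≤ t.bCut k μ := by
  have h1 := h.rho_subgradient μ hμ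
  have h2 : penalty R μ w ≤ (b : EReal) := iSup₂_le fun u hu => EReal.coe_le_coe_iff.2 (hb u hu)
  rw [← h.bval_eq, ← EReal.coe_neg, ← EReal.coe_add] at h1
  have h3 := (EReal.neg_le_neg_iff.2 h2).trans h1
  rwa [← EReal.coe_neg, EReal.coe_le_coe_iff] at h3

end IsEvaluation

namespace IsRun

theorem mem_idx (h : t.IsRun D w R ϱ γ μ₁ lam₁ m) (hk : k ≤ m) :
    ∀ ℓ ∈ t.idx k, 1 ≤ ℓ ∧ ℓ ≤ k := by
  induction k with
  | zero => simp [h.idx_zero]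
  | succ k ih =>
    intro ℓ hℓ
    have ih' := ih (by omega) ℓ
    rcases (h.evaluation (k + 1) (by omega) hk).idx_update with he | ⟨-, -, he⟩
    · rw [he, Finset.mem_insert] at hℓ
      rcases hℓ with rfl | hℓ
      · omega
      · have := ih' hℓ; omega
    · rw [he] at hℓ
      have := ih' hℓ; omega

theorem idx_subset (h : t.IsRun D w R ϱ γ μ₁ lam₁ m) (hkn : k ≤ n) (hn : n ≤ m) :
    t.idx k ⊆ t.idx n := by
  induction n, hkn using Nat.le_induction with
  | base => exact subset_rfl
  | succ n hkn ih =>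
    refine (ih (by omega)).trans ?_
    rcases (h.evaluation (n + 1) (by omega) hn).idx_update with he | ⟨-, -, he⟩
    · rw [he]; exact Finset.subset_insert _ _
    · rw [he]; exact subset_rfl

theorem idx_nonempty (h : t.IsRun D w R ϱ γ μ₁ lam₁ m) (hk : 1 ≤ k) (hkm : k ≤ m) :
    (t.idx k).Nonempty := by
  refine Finset.Nonempty.mono (h.idx_subset hk hkm) ?_
  rcases (h.evaluation 1 le_rfl (hk.trans hkm)).idx_update with he | ⟨h2, -⟩
  · rw [he]; exact Finset.insert_nonempty _ _
  · omega

theorem iterate_feasible (h : t.IsRun D w R ϱ γ μ₁ lam₁ m) (hμ₁ : μ₁ ∈ probVectors I J)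
    (hlam₁ : MeanZero D lam₁) (hk : 1 ≤ k) (hkm : k ≤ m) :
    t.mu k ∈ probVectors I J ∧ MeanZero D (t.lam k) := by
  rcases hk.eq_or_lt with rfl | hk
  · rw [h.start_mu, h.start_lam]; exact ⟨hμ₁, hlam₁⟩
  · obtain ⟨j, rfl⟩ : ∃ j, k = j + 1 := ⟨k - 1, by omega⟩
    have hq := (h.master_step j (by omega) (by omega)).master.1
    refine ⟨⟨hq.mu_nonneg, fun j' => ?_⟩, hq.mean_zero⟩
    have := congrFun hq.mu_sum j'
    simpa using this

theorem isDualBound (h : t.IsRun D w R ϱ γ μ₁ lam₁ m) (hμ₁ : μ₁ ∈ probVectors I J)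
    (hlam₁ : MeanZero D lam₁) (hk : 1 ≤ k) (hkm : k ≤ m) :
    IsDualBound D R w (t.mu k) (t.lam k) (t.fval k) (t.bval k) :=
  (h.evaluation k hk hkm).isDualBound (h.iterate_feasible hμ₁ hlam₁ hk hkm).1
    (h.iterate_feasible hμ₁ hlam₁ hk hkm).2

theorem exists_center (h : t.IsRun D w R ϱ γ μ₁ lam₁ m) (hk : 1 ≤ k) (hkm : k ≤ m) :
    ∃ j, 1 ≤ j ∧ j ≤ m ∧ t.cmu k = t.mu j ∧ t.clam k = t.lam j := by
  induction k, hk using Nat.le_induction with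
  | base =>
    have h1 := (h.evaluation 1 le_rfl hkm).center_descent (Or.inl rfl)
    exact ⟨1, le_rfl, hkm, h1⟩
  | succ k hk ih =>
    have he := h.evaluation (k + 1) (by omega) hkm
    by_cases hd : t.IsDescent γ (k + 1)
    · exact ⟨k + 1, by omega, hkm, he.center_descent hd⟩
    · obtain ⟨j, hj, hjm, h1, h2⟩ := ih (by omega)
      obtain ⟨h3, h4⟩ := he.center_null hd
      exact ⟨j, hj, hjm, h3.trans h1, h4.trans h2⟩

theorem Fbar_eq_F (h : t.IsRun D w R ϱ γ μ₁ lam₁ m) (hk : 1 ≤ k) (hkm : k < m) {j : ℕ}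
    (hj : 1 ≤ j) (hjm : j ≤ m) (hmu : t.cmu k = t.mu j) (hlam : t.clam k = t.lam j) :
    t.Fbar (k + 1) = t.F j := by
  have he := h.evaluation j hj hjm
  have h1 := (h.master_step k hk hkm).Fbar_eq
  rw [hmu, hlam, dualObjective, ← he.bval_eq, ← Finset.sum_congr rfl fun i _ => he.fval_eq i]
    at h1
  have h2 : ∀ s : Finset (Fin I), ∑ i ∈ s, ((t.fval j i : ℝ) : EReal)
      = ((∑ i ∈ s, t.fval j i : ℝ) : EReal) := fun s =>
    (map_sum (⟨⟨Real.toEReal, rfl⟩, EReal.coe_add⟩ : ℝ →+ EReal) (t.fval j) s).symm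
  rw [h2, ← EReal.coe_sub, EReal.coe_eq_coe_iff] at h1
  exact h1

theorem exists_isDualBound_center (h : t.IsRun D w R ϱ γ μ₁ lam₁ m)
    (hμ₁ : μ₁ ∈ probVectors I J) (hlam₁ : MeanZero D lam₁) (hk : 1 ≤ k) (hkm : k < m) :
    ∃ a b, IsDualBound D R w (t.cmu k) (t.clam k) a b ∧ t.Fbar (k + 1) = ∑ i, a i - b := by
  obtain ⟨j, hj, hjm, hmu, hlam⟩ := h.exists_center hk hkm.le
  refine ⟨t.fval j, t.bval j, ?_, h.Fbar_eq_F hk hkm hj hjm hmu hlam⟩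
  rw [hmu, hlam]
  exact h.isDualBound hμ₁ hlam₁ hj hjm

/-- The cuts overestimate the concave dual objective, so every dual lower bound is admissible in
every master problem of the run. -/
theorem masterFeasible (h : t.IsRun D w R ϱ γ μ₁ lam₁ m) (hkm : k ≤ m)
    {μ : Fin I → Fin J → ℝ} {lam : Fin I → Fin M → ℝ} {a : Fin I → ℝ} {b : ℝ}
    (hb : IsDualBound D R w μ lam a b) : t.MasterFeasible D w (t.idx k) ⟨μ, lam, a, -b⟩ := by
  refine ⟨fun i ℓ hℓ => ?_, fun ℓ hℓ => ?_, hb.mean, ?_, hb.mem.1⟩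
  · obtain ⟨h1, h2⟩ := h.mem_idx hkm ℓ hℓ
    have he := h.evaluation ℓ h1 (h2.trans hkm)
    rw [he.fCut_eq_subObjective]
    exact hb.le_sub i _ (he.sub_feasible i)
  · obtain ⟨h1, h2⟩ := h.mem_idx hkm ℓ hℓ
    exact (h.evaluation ℓ h1 (h2.trans hkm)).neg_le_bCut hb.mem hb.le_pen
  · funext j
    simpa using hb.mem.2 j

/-- The first dual value depends only on the starting point; this makes the constants below uniform
over all runs. -/
theorem F_one_eq {t' : Trace I J M N} {m' : ℕ} (h : t.IsRun D w R ϱ γ μ₁ lam₁ m)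
    (h' : t'.IsRun D w R ϱ γ μ₁ lam₁ m') (hm : 1 ≤ m) (hm' : 1 ≤ m') : t.F 1 = t'.F 1 := by
  have he := h.evaluation 1 le_rfl hm
  have he' := h'.evaluation 1 le_rfl hm'
  have h1 : t.fval 1 = t'.fval 1 := by
    funext i
    rw [← EReal.coe_eq_coe_iff, he.fval_eq, he'.fval_eq, h.start_mu, h.start_lam, h'.start_mu,
      h'.start_lam]
  have h2 : t.bval 1 = t'.bval 1 := by
    rw [← EReal.coe_eq_coe_iff, he.bval_eq, he'.bval_eq, h.start_mu, h'.start_mu]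
  rw [F, F, h1, h2]

/-- The centers stay within a bounded distance of a dual optimal point. -/
theorem sqDist_center_le (h : t.IsRun D w R ϱ γ μ₁ lam₁ m) (hϱ : 0 < ϱ) (hγ : 0 < γ)
    (hμ₁ : μ₁ ∈ probVectors I J) (hlam₁ : MeanZero D lam₁)
    {μ : Fin I → Fin J → ℝ} {lam : Fin I → Fin M → ℝ} {a : Fin I → ℝ} {b : ℝ}
    (hb : IsDualBound D R w μ lam a b)
    (hmax : ∀ μ' lam' a' b', IsDualBound D R w μ' lam' a' b' → ∑ i, a' i - b' ≤ ∑ i, a i - b)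
    (hk : 1 ≤ k) (hkm : k < m) :
    ϱ * (sqDist μ (t.cmu k) + sqDist lam (t.clam k))
      ≤ ϱ * (sqDist μ μ₁ + sqDist lam lam₁) + (t.Fbar (k + 1) - t.F 1) / γ := by
  induction k, hk using Nat.le_induction with
  | base =>
    obtain ⟨h1, h2⟩ := (h.evaluation 1 le_rfl hkm.le).center_descent (Or.inl rfl)
    rw [h.Fbar_eq_F le_rfl hkm le_rfl hkm.le h1 h2, h1, h2, h.start_mu, h.start_lam]
    simp
  | succ k hk ih =>
    have ih := ih (by omega)
    have he := h.evaluation (k + 1) (by omega) hkm.le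
    by_cases hd : t.IsDescent γ (k + 1)
    · obtain ⟨h1, h2⟩ := he.center_descent hd
      rw [h.Fbar_eq_F (by omega) hkm (by omega) hkm.le h1 h2, h1, h2]
      -- Strong concavity against the dual optimal point bounds the growth of the squared distance
      -- by model value minus center value. The descent test bounds this by the actual increase
      -- divided by `γ`, which telescopes.
      have h3 := (h.master_step k hk (by omega)).master.add_sqDist_le
        (h.masterFeasible (by omega) hb)
      rw [masterObjective_eq, masterObjective_eq] at h3
      dsimp only at h3
      have h4 := mul_nonneg hϱ.le (add_nonneg (sqDist_nonneg (t.mu (k + 1)) (t.cmu k))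
        (sqDist_nonneg (t.lam (k + 1)) (t.clam k)))
      obtain ⟨a', b', hb', hF⟩ := h.exists_isDualBound_center hμ₁ hlam₁ hk (by omega)
      have h5 := hmax _ _ _ _ hb'
      rw [← hF] at h5
      have h6 : (1 - γ) * t.Fbar (k + 1) + γ * t.modelValue (k + 1) ≤ t.F (k + 1) := by
        rcases hd with hd | hd
        · omega
        · exact hd.2
      have h7 : t.modelValue (k + 1) - t.Fbar (k + 1)
          ≤ (t.F (k + 1) - t.Fbar (k + 1)) / γ := by
        rw [le_div_iff₀ hγ]
        linarith
      have h8 : (t.F (k + 1) - t.F 1) / γ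
          = (t.F (k + 1) - t.Fbar (k + 1)) / γ + (t.Fbar (k + 1) - t.F 1) / γ := by ring
      rw [modelValue] at h7
      linarith
    · obtain ⟨h1, h2⟩ := he.center_null hd
      rw [Nat.add_sub_cancel] at h1 h2
      have h3 := (h.master_step (k + 1) (by omega) hkm).Fbar_eq
      rw [h1, h2, ← (h.master_step k hk (by omega)).Fbar_eq, EReal.coe_eq_coe_iff] at h3
      rw [h1, h2, h3]
      exact ih

end IsRun

/-! ### Estimates for the recovered solution. -/

namespace IsRecovery

variable {d : DualVars I J M} {z : Fin J → ℝ}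

theorem one_le (h : t.IsRecovery D w R ϱ γ μ₁ lam₁ ε k n d z) : 1 ≤ k := h.stopped.1.1

theorem le (h : t.IsRecovery D w R ϱ γ μ₁ lam₁ ε k n d z) : k ≤ n :=
  Nat.lt_succ_iff.1 h.descent.1.1

theorem idx_nonempty (h : t.IsRecovery D w R ϱ γ μ₁ lam₁ ε k n d z) : (t.idx n).Nonempty :=
  h.run.idx_nonempty (h.one_le.trans h.le) (Nat.le_succ n)

theorem normalized (h : t.IsRecovery D w R ϱ γ μ₁ lam₁ ε k n d z) (hϱ : 0 < ϱ) :
    d.Normalized (t.idx n) :=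
  h.dual.normalized hϱ h.idx_nonempty

theorem evaluation (h : t.IsRecovery D w R ϱ γ μ₁ lam₁ ε k n d z) {ℓ : ℕ} (hℓ : ℓ ∈ t.idx n) :
    t.IsEvaluation D w R γ ℓ := by
  obtain ⟨h1, h2⟩ := h.run.mem_idx (Nat.le_succ n) ℓ hℓ
  exact h.run.evaluation ℓ h1 (h2.trans (Nat.le_succ n))

theorem mem_scenarioSet (h : t.IsRecovery D w R ϱ γ μ₁ lam₁ ε k n d z) (hϱ : 0 < ϱ)
    (i : Fin I) : (t.recX (t.idx n) d i, t.recY (t.idx n) d i) ∈ scenarioSet D i := by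
  have h1 := (convex_scenarioSet D i).sum_mem (t := t.idx n) (w := d.τ i)
    (z := fun ℓ => (t.x ℓ i, t.y ℓ i)) (fun ℓ hℓ => h.dual.1.τ_nonneg i ℓ hℓ)
    ((h.normalized hϱ).1 i) (fun ℓ hℓ => (h.evaluation hℓ).sub_feasible i)
  convert h1 using 1
  refine Prod.ext ?_ ?_
  · simp [Prod.fst_sum, recX]
  · simp [Prod.snd_sum, recY]

/-- Iteration `n + 1` is the first descent iteration after `k`, so all iterations in between leave
the centers alone. -/
theorem center_eq (h : t.IsRecovery D w R ϱ γ μ₁ lam₁ ε k n d z) :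
    t.cmu n = t.cmu k ∧ t.clam n = t.clam k := by
  have : ∀ j, k ≤ j → j ≤ n → t.cmu j = t.cmu k ∧ t.clam j = t.clam k := by
    intro j hj
    induction j, hj using Nat.le_induction with
    | base => exact fun _ => ⟨rfl, rfl⟩
    | succ j hj ih =>
      intro hjn
      have hnd : ¬ t.IsDescent γ (j + 1) := fun hd => by
        have := h.descent.2 ⟨Nat.lt_succ_of_le hj, hd⟩
        omega
      obtain ⟨h1, h2⟩ := (h.run.evaluation (j + 1) (by omega) (by omega)).center_null hnd
      obtain ⟨h3, h4⟩ := ih (by omega)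
      exact ⟨h1.trans h3, h2.trans h4⟩
  exact this n h.le le_rfl

/-- The master problem of iteration `n` has the centers of iteration `k`. -/
theorem master (h : t.IsRecovery D w R ϱ γ μ₁ lam₁ ε k n d z) :
    t.IsMasterOptimal D w ϱ k (t.idx n)
      ⟨t.mu (n + 1), t.lam (n + 1), t.vartheta (n + 1), t.eta (n + 1)⟩ := by
  have h1 := (h.run.master_step n (h.one_le.trans h.le) (Nat.lt_succ_self n)).master
  obtain ⟨h2, h3⟩ := h.center_eq
  refine ⟨h1.1, fun q' hq' => ?_⟩
  have h4 := h1.2 q' hq'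
  rw [masterObjective_eq, masterObjective_eq] at h4 ⊢
  rwa [h2, h3] at h4

/-- With unchanged centers, additional cuts can only lower the optimal value; at iteration `k` the
stopping rule bounds it. -/
theorem masterObjective_le (h : t.IsRecovery D w R ϱ γ μ₁ lam₁ ε k n d z) (hϱ : 0 < ϱ) :
    t.masterObjective ϱ k ⟨t.mu (n + 1), t.lam (n + 1), t.vartheta (n + 1), t.eta (n + 1)⟩
      ≤ t.Fbar (k + 1) + ε := by
  have hkn := h.le
  have hsub := h.run.idx_subset hkn (Nat.le_succ n)
  have hf := h.master.1
  have h1 := (h.run.master_step k h.one_le (by omega)).master.2 _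
    ⟨fun i ℓ hℓ => hf.cut_f i ℓ (hsub hℓ), fun ℓ hℓ => hf.cut_b ℓ (hsub hℓ), hf.mean_zero,
      hf.mu_sum, hf.mu_nonneg⟩
  refine h1.trans ?_
  rw [masterObjective_eq]
  have h2 := h.stopped.1.2
  have h3 := mul_nonneg hϱ.le (add_nonneg (sqDist_nonneg (t.mu (k + 1)) (t.cmu k))
    (sqDist_nonneg (t.lam (k + 1)) (t.clam k)))
  rw [modelValue] at h2
  dsimp only
  linarith

/-- The centers are feasible with objective `Fbar (k + 1)`, so at most `ε` remains for the strong
concavity term. -/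
theorem sqDist_step_le (h : t.IsRecovery D w R ϱ γ μ₁ lam₁ ε k n d z) (hϱ : 0 < ϱ)
    (hμ₁ : μ₁ ∈ probVectors I J) (hlam₁ : MeanZero D lam₁) :
    ϱ * (sqDist (t.cmu k) (t.mu (n + 1)) + sqDist (t.clam k) (t.lam (n + 1))) ≤ ε := by
  have hkn := h.le
  obtain ⟨a, b, hb, hF⟩ := h.run.exists_isDualBound_center hμ₁ hlam₁ h.one_le (by omega)
  have h1 := h.master.add_sqDist_le (h.run.masterFeasible (Nat.le_succ n) hb)
  have h2 := h.masterObjective_le hϱ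
  rw [masterObjective_eq] at h1
  have h0 : ∀ {m n : ℕ} (a : Fin m → Fin n → ℝ), sqDist a a = 0 := fun a => by simp [sqDist]
  simp only [h0] at h1
  linarith

/-- Stationarity in `λ_i`: the gradient of the nonproximal part is `p_i (x_i - σ)` and must balance
the proximal force. -/
theorem recX_sub (h : t.IsRecovery D w R ϱ γ μ₁ lam₁ ε k n d z) (hϱ : 0 < ϱ) (i : Fin I)
    (m : Fin M) : t.recX (t.idx n) d i m - d.σ m
      = 2 * ϱ / D.p i * (t.lam (n + 1) i m - t.clam k i m) := by
  have h1 := congrFun (congrFun (h.dual.eq_of_isMasterOptimal hϱ h.idx_nonempty h.master).1 i) m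
  have h2 : t.gradLam D (t.idx n) d i m = D.p i * (t.recX (t.idx n) d i m - d.σ m) := by
    simp only [gradLam, glam, recX, Pi.sub_apply, Finset.sum_apply, Pi.smul_apply, smul_eq_mul,
      mul_sub, Finset.mul_sum]
    congr 1
    exact Finset.sum_congr rfl fun ℓ _ => by ring
  have hp := (D.p_pos i).ne'
  simp only [maxLam, Pi.add_apply, Pi.smul_apply, smul_eq_mul, h2] at h1
  rw [h1]
  field_simp
  ring

/-- At `λ = 0` a cut is the weighted cost of a subproblem solution, linear in that solution, so
averaging with `τ` gives the cost of the recovered decision. -/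
theorem sum_fCut (h : t.IsRecovery D w R ϱ γ μ₁ lam₁ ε k n d z) (μ : Fin I → Fin J → ℝ) :
    ∑ i, ∑ ℓ ∈ t.idx n, d.τ i ℓ * t.fCut D w ℓ i (μ i) 0
      = weightedExp w μ (totalCost D (t.recX (t.idx n) d) (t.recY (t.idx n) d)) := by
  rw [weightedExp_eq_sum]
  refine Finset.sum_congr rfl fun i _ => ?_
  have h1 : totalCost D (t.recX (t.idx n) d) (t.recY (t.idx n) d) i
      = ∑ ℓ ∈ t.idx n, d.τ i ℓ • scenarioCost D i (t.x ℓ i) (t.y ℓ i) := by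
    simp only [totalCost, scenarioCost, recX, recY, Matrix.mulVec_sum, Matrix.mulVec_smul,
      smul_add, Finset.sum_add_distrib]
  rw [h1, Finset.mul_sum, dotProduct_sum]
  refine Finset.sum_congr rfl fun ℓ hℓ => ?_
  rw [(h.evaluation hℓ).fCut_eq_subObjective, subObjective, zero_dotProduct, mul_zero, add_zero,
    mul_smul_comm, dotProduct_smul, smul_eq_mul]

/-- The scalarized risk of the recovered decision is bounded by the dual objective at the centers,
up to terms that vanish with the last proximal step. -/
theorem dotProduct_le (h : t.IsRecovery D w R ϱ γ μ₁ lam₁ ε k n d z) (hϱ : 0 < ϱ)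
    (hR : IsConvexRiskMeasure R) (hw : ∀ j, 0 ≤ w j) (hw' : w ≠ 0) :
    ∃ μ ∈ probVectors I J, w ⬝ᵥ z ≤ t.Fbar (k + 1) + ε
      + ϱ * (sqDist μ (t.cmu k) - sqDist μ (t.mu (n + 1)))
      + ϱ * (sqDist 0 (t.clam k) - sqDist 0 (t.lam (n + 1))) := by
  have := nonempty_scenarios D
  obtain ⟨μ, hμ, hpen⟩ := exists_probVector_of_minimizer hR hw hw' h.z_mem h.z_min
  refine ⟨μ, hμ, ?_⟩
  -- Taking `λ = 0` removes the terms with `σ` and with the first-stage prices; normalization makes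
  -- `vartheta` and `eta` irrelevant, so they are zero.
  have h1 := (h.dual.eq_of_isMasterOptimal hϱ h.idx_nonempty h.master).2 ⟨μ, 0, 0, 0⟩
  have h2 := h.masterObjective_le hϱ
  have hsum : ∑ i, μ i = 1 := by
    funext j
    simpa using hμ.2 j
  have h3 : 0 ≤ ∑ i, d.ν i ⬝ᵥ μ i :=
    Finset.sum_nonneg fun i _ => Finset.sum_nonneg fun j _ =>
      mul_nonneg (h.dual.1.ν_nonneg i j) (hμ.1 i j)
  set û := totalCost D (t.recX (t.idx n) d) (t.recY (t.idx n) d)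
  have h4 : -(weightedExp w μ û - w ⬝ᵥ z) ≤ ∑ ℓ ∈ t.idx n, d.θ ℓ * t.bCut ℓ μ := by
    have : ∑ ℓ ∈ t.idx n, d.θ ℓ * -(weightedExp w μ û - w ⬝ᵥ z)
        = -(weightedExp w μ û - w ⬝ᵥ z) := by
      rw [← Finset.sum_mul, (h.normalized hϱ).2, one_mul]
    rw [← this]
    exact Finset.sum_le_sum fun ℓ hℓ => mul_le_mul_of_nonneg_left
      ((h.evaluation hℓ).neg_le_bCut hμ hpen) (h.dual.1.θ_nonneg ℓ hℓ)
  rw [lagrangian, masterObjective_eq] at h1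
  simp only [Pi.zero_apply, sub_zero, h.sum_fCut, smul_zero, Finset.sum_const_zero,
    dotProduct_zero, hsum, sub_self] at h1
  linarith

end IsRecovery

end Trace

/-! ### Uniform constants. -/

theorem sqDist_sub_sqDist_le {m n : ℕ} {x c c' : Fin m → Fin n → ℝ} {B r : ℝ}
    (hr : ∀ i j, |c i j - c' i j| ≤ r) (hB : ∀ i j, |x i j - c i j| ≤ B) :
    sqDist x c - sqDist x c' ≤ m * n * (2 * B * r) := by
  have h : sqDist x c - sqDist x c' ≤ ∑ _i : Fin m, ∑ _j : Fin n, 2 * B * r := by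
    simp only [sqDist, ← Finset.sum_sub_distrib]
    refine Finset.sum_le_sum fun i _ => Finset.sum_le_sum fun j _ => ?_
    have h1 : (x i j - c i j) * (-(c i j - c' i j)) ≤ B * r := by
      refine (le_abs_self _).trans ?_
      rw [abs_mul, abs_neg]
      exact mul_le_mul (hB i j) (hr i j) (abs_nonneg _) ((abs_nonneg _).trans (hB i j))
    nlinarith [sq_nonneg (c i j - c' i j)]
  refine h.trans (le_of_eq ?_)
  simp only [Finset.sum_const, Finset.card_univ, Fintype.card_fin, nsmul_eq_mul]
  ring

theorem abs_sub_le_sqrt {m n : ℕ} {a b : Fin m → Fin n → ℝ} {s : ℝ} (h : sqDist a b ≤ s)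
    (i : Fin m) (j : Fin n) : |a i j - b i j| ≤ √s :=
  Real.abs_le_sqrt ((sq_sub_le_sqDist a b i j).trans h)

variable {I J K L M N : ℕ} {D : Data I J K L M N} {R : (Fin I → Fin J → ℝ) → Set (Fin J → ℝ)}
  {w : Fin J → ℝ} {ϱ γ : ℝ} {μ₁ : Fin I → Fin J → ℝ} {lam₁ : Fin I → Fin M → ℝ}

/-- Explicit rates: there is a constant `B` such that every recovery for the tolerance `ε` has
errors of the order `√ε`. -/
theorem exists_recovery_estimate (hX' : (feasibleSet D).Nonempty) (hR : IsConvexRiskMeasure R)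
    (hw : ∀ j, 0 ≤ w j) (hw' : w ≠ 0) (hϱ : 0 < ϱ) (hγ : 0 < γ)
    (hμ₁ : μ₁ ∈ probVectors I J) (hlam₁ : MeanZero D lam₁) :
    ∃ B : ℝ, ∀ (ε : ℝ) (t : Trace I J M N) (k n : ℕ) (d : DualVars I J M) (z : Fin J → ℝ), 0 < ε →
      t.IsRecovery D w R ϱ γ μ₁ lam₁ ε k n d z →
        (∀ i m, |t.recX (t.idx n) d i m - d.σ m| ≤ 2 * ϱ / D.p i * √(ε / ϱ)) ∧
        w ⬝ᵥ z ≤ t.Fbar (k + 1) + (ε + B * √(ε / ϱ)) := by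
  -- Without any recovery the claim is vacuous. Otherwise one reference run provides a dual feasible
  -- point, hence a dual optimal one.
  by_cases hex : ∃ (ε : ℝ) (t : Trace I J M N) (k n : ℕ) (d : DualVars I J M) (z : Fin J → ℝ),
      t.IsRecovery D w R ϱ γ μ₁ lam₁ ε k n d z
  swap
  · exact ⟨0, fun ε t k n d z _ h => absurd ⟨ε, t, k, n, d, z, h⟩ hex⟩
  obtain ⟨_, t₀, _, _, _, _, h₀⟩ := hex
  obtain ⟨μ, lam, a, b, hb, hmax⟩ := exists_isDualBound_max hX' hR
    ⟨_, _, _, _, h₀.run.isDualBound hμ₁ hlam₁ le_rfl (Nat.le_add_left 1 _)⟩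
  -- The bound of `IsRun.sqDist_center_le` with the center value replaced by the maximal dual value;
  -- `t₀.F 1` is common to all runs.
  set B₀ := (ϱ * (sqDist μ μ₁ + sqDist lam lam₁) + (∑ i, a i - b - t₀.F 1) / γ) / ϱ with hB₀
  set B₁ := √(sqDist lam 0) + √B₀
  refine ⟨ϱ * (I * J * 2 + I * M * (2 * B₁)), fun ε t k n d z hε h => ?_⟩
  have hkn := h.le
  set r := √(ε / ϱ)
  have hstep := h.sqDist_step_le hϱ hμ₁ hlam₁
  rw [← le_div_iff₀' hϱ] at hstep
  have hn1 := sqDist_nonneg (t.cmu k) (t.mu (n + 1))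
  have hn2 := sqDist_nonneg (t.clam k) (t.lam (n + 1))
  have hrmu : ∀ i j, |t.cmu k i j - t.mu (n + 1) i j| ≤ r := abs_sub_le_sqrt (by linarith)
  have hrlam : ∀ i m, |t.clam k i m - t.lam (n + 1) i m| ≤ r := abs_sub_le_sqrt (by linarith)
  obtain ⟨a', b', hc, hF⟩ := h.run.exists_isDualBound_center hμ₁ hlam₁ h.one_le (by omega)
  refine ⟨fun i m => ?_, ?_⟩
  · have hp := D.p_pos i
    rw [h.recX_sub hϱ, abs_mul, abs_of_pos (by positivity), abs_sub_comm]
    exact mul_le_mul_of_nonneg_left (hrlam i m) (by positivity)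
  · obtain ⟨μ', hμ', hle⟩ := h.dotProduct_le hϱ hR hw hw'
    have h1 : sqDist μ' (t.cmu k) - sqDist μ' (t.mu (n + 1)) ≤ I * J * (2 * 1 * r) := by
      refine sqDist_sub_sqDist_le hrmu fun i j => ?_
      rw [abs_le]
      constructor <;> linarith [hμ'.1 i j, probVectors_le_one hμ' i j, hc.mem.1 i j,
        probVectors_le_one hc.mem i j]
    have hcen := h.run.sqDist_center_le hϱ hγ hμ₁ hlam₁ hb hmax h.one_le (by omega)
    have hFle := hmax _ _ _ _ hc
    rw [← hF] at hFle
    have hB : sqDist lam (t.clam k) ≤ B₀ := by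
      have h2 := sqDist_nonneg μ (t.cmu k)
      rw [hB₀, le_div_iff₀' hϱ]
      have h3 : (t.Fbar (k + 1) - t.F 1) / γ ≤ (∑ i, a i - b - t₀.F 1) / γ := by
        rw [h.run.F_one_eq h₀.run (Nat.le_add_left 1 _) (Nat.le_add_left 1 _)]
        exact div_le_div_of_nonneg_right (by linarith) hγ.le
      have h4 := mul_nonneg hϱ.le h2
      linarith
    have h2 : sqDist 0 (t.clam k) - sqDist 0 (t.lam (n + 1)) ≤ I * M * (2 * B₁ * r) := by
      refine sqDist_sub_sqDist_le hrlam fun i m => ?_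
      have h5 := abs_sub_le_sqrt hB i m
      have h6 := abs_sub_le_sqrt (le_refl (sqDist lam 0)) i m
      have h7 := abs_sub_le ((0 : Fin I → Fin M → ℝ) i m) (lam i m) (t.clam k i m)
      rw [abs_sub_comm _ (lam i m)] at h7
      exact h7.trans (add_le_add h6 h5)
    have h3 := mul_le_mul_of_nonneg_left h1 hϱ.le
    have h4 := mul_le_mul_of_nonneg_left h2 hϱ.le
    linarith

/-- Weak duality for the extended real optimal value. -/
theorem IsDualBound.le_optimalValue {μ : Fin I → Fin J → ℝ} {lam : Fin I → Fin M → ℝ}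
    {a : Fin I → ℝ} {b : ℝ} (hR : IsConvexRiskMeasure R) (h : IsDualBound D R w μ lam a b) :
    ((∑ i, a i - b : ℝ) : EReal) ≤ optimalValue D R w :=
  le_iInf₂ fun _ hv => le_iInf₂ fun _ hz => EReal.coe_le_coe_iff.2 (h.le_dotProduct hR hv hz)

/-- A scenariowise cost that is close to the cost of a feasible decision bounds the optimal
value. -/
theorem optimalValue_le_of_near (hR : IsConvexRiskMeasure R) {u : Fin I → Fin J → ℝ}
    {z : Fin J → ℝ} (hz : z ∈ R u) {v : (Fin M → ℝ) × (Fin I → Fin N → ℝ)}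
    (hv : v ∈ feasibleSet D) {e : ℝ}
    (h : ∀ i j, |totalCost D (fun _ => v.1) v.2 i j - u i j| < e) :
    optimalValue D R w ≤ ((w ⬝ᵥ z + (∑ j, w j) * e : ℝ) : EReal) := by
  have h1 : z + (fun _ => e) ∈ R (totalCost D (fun _ => v.1) v.2) :=
    hR.mem_add hz fun i j => by linarith [(abs_lt.1 (h i j)).2]
  have h2 : w ⬝ᵥ (z + fun _ => e) = w ⬝ᵥ z + (∑ j, w j) * e := by
    rw [dotProduct_add, Finset.sum_mul]; rfl
  rw [← h2]
  exact (iInf₂_le v hv).trans (iInf₂_le _ h1)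

end TwoStage

end

open TwoStage
theorem theorem5p3 {I J K L M N : ℕ} (D : Data I J K L M N)
    (hX : IsCompact (feasibleSet D)) (hX' : (feasibleSet D).Nonempty)
    (R : (Fin I → Fin J → ℝ) → Set (Fin J → ℝ)) (hR : IsConvexRiskMeasure R)
    (w : Fin J → ℝ) (hw : ∀ j, 0 ≤ w j) (hw' : w ≠ 0)
    (ϱ : ℝ) (hϱ : 0 < ϱ) (γ : ℝ) (hγ : 0 < γ) (hγ' : γ < 1)
    (μ₁ : Fin I → Fin J → ℝ) (hμ₁ : μ₁ ∈ probVectors I J)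
    (lam₁ : Fin I → Fin M → ℝ) (hlam₁ : MeanZero D lam₁) :
    (∀ (ε : ℝ) (t : Trace I J M N) (k n : ℕ) (d : DualVars I J M) (z : Fin J → ℝ), 0 < ε →
      t.IsRecovery D w R ϱ γ μ₁ lam₁ ε k n d z →
        (∀ i, (t.recX (t.idx n) d i, t.recY (t.idx n) d i) ∈ scenarioSet D i) ∧
        z ∈ R (totalCost D (t.recX (t.idx n) d) (t.recY (t.idx n) d))) ∧
    (∀ δ : ℝ, 0 < δ → ∃ ε₀ : ℝ, 0 < ε₀ ∧
      ∀ (ε : ℝ) (t : Trace I J M N) (k n : ℕ) (d : DualVars I J M) (z : Fin J → ℝ), 0 < ε →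
        ε ≤ ε₀ → t.IsRecovery D w R ϱ γ μ₁ lam₁ ε k n d z →
          (∀ i, ‖t.recX (t.idx n) d i - d.σ‖ < δ) ∧
          ((w ⬝ᵥ z - δ : ℝ) : EReal) < optimalValue D R w ∧
          optimalValue D R w < ((w ⬝ᵥ z + δ : ℝ) : EReal)) := by
  refine ⟨fun ε t k n d z _ h => ⟨h.mem_scenarioSet hϱ, h.z_mem⟩, fun δ hδ => ?_⟩
  obtain ⟨B, hB⟩ := exists_recovery_estimate hX' hR hw hw' hϱ hγ hμ₁ hlam₁
  have hW : 0 ≤ ∑ j, w j := Finset.sum_nonneg fun j _ => hw j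
  -- A cost error `e` in every coordinate changes `wᵀz` by `e` times the sum of the `w j`, which
  -- stays below `δ` for this tolerance.
  obtain ⟨η, hη, hnear⟩ := exists_feasible_cost_near D hX hX'
    (show 0 < δ / (∑ j, w j + 1) by positivity)
  have hsqrt : Filter.Tendsto (fun ε : ℝ => √(ε / ϱ)) (nhds 0) (nhds 0) := by
    have : Continuous fun ε : ℝ => √(ε / ϱ) := by fun_prop
    simpa using this.tendsto 0
  have h1 : ∀ᶠ ε : ℝ in nhds 0, ε + B * √(ε / ϱ) < δ := by
    have h := Filter.Tendsto.add (f := fun ε : ℝ => ε) Filter.tendsto_id (hsqrt.const_mul B)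
    rw [mul_zero, add_zero] at h
    exact h.eventually_lt_const hδ
  have h2 : ∀ᶠ ε : ℝ in nhds 0, ∀ i, 2 * ϱ / D.p i * √(ε / ϱ) < min δ η := by
    refine Filter.eventually_all.2 fun i => ?_
    have h := hsqrt.const_mul (2 * ϱ / D.p i)
    rw [mul_zero] at h
    exact h.eventually_lt_const (lt_min hδ hη)
  obtain ⟨e, he, hball⟩ := Metric.eventually_nhds_iff.1 (h1.and h2)
  refine ⟨e / 2, half_pos he, fun ε t k n d z hε hεe h => ?_⟩
  obtain ⟨hδB, hp⟩ := hball (y := ε) (by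
    rw [Real.dist_eq, sub_zero, abs_of_pos hε]; linarith)
  obtain ⟨hx, hz⟩ := hB ε t k n d z hε h
  have hnorm : ∀ i, ‖t.recX (t.idx n) d i - d.σ‖ < min δ η := fun i =>
    (pi_norm_lt_iff (lt_min hδ hη)).2 fun m => (hx i m).trans_lt (hp i)
  refine ⟨fun i => (hnorm i).trans_le (min_le_left _ _), ?_, ?_⟩
  -- The dual value at the centers lies below the optimal value by weak duality, and `wᵀz` exceeds
  -- it by less than `δ`.
  · have hkn := h.le
    obtain ⟨a, b, hb, hF⟩ := h.run.exists_isDualBound_center hμ₁ hlam₁ h.one_le (by omega)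
    refine lt_of_lt_of_le (EReal.coe_lt_coe_iff.2 ?_) (hb.le_optimalValue hR)
    rw [← hF]
    linarith
  · obtain ⟨v, hv, hclose⟩ := hnear _ _ d.σ (h.mem_scenarioSet hϱ)
      fun i => (hnorm i).trans_le (min_le_right _ _)
    refine lt_of_le_of_lt (optimalValue_le_of_near hR h.z_mem hv hclose)
      (EReal.coe_lt_coe_iff.2 ?_)
    have : (∑ j, w j) * (δ / (∑ j, w j + 1)) < δ := by
      rw [mul_div_assoc', div_lt_iff₀ (by positivity)]
      linarith
    linarith
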